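/- **Setting.** A *base sequence* is a sequence of integers $0=k_0<k_1<k_2<\cdots$; it is *special* if $k_{j+1}/k_j$, $j\ge 1$, is bounded. A *weight sequence* is a sequence $M=(M_j)_{j\ge0}$ of positive reals with $M_0=1\le M_1\le \mu_2\le\mu_3\le\cdots$, where $\mu_j=M_j/M_{j-1}$; put $m_j=M_j^{1/j}$ for $j\ge 1$ and $m_0=1$. Functions are real- or complex-valued. For a smooth function $f$ on an open subset of $\mathbb R^n$, an open subset $\Omega$ of its domain, $1\le p\le\infty$ and $C,\rho>0$ consider the estimates $$\|\partial^\alpha f\|_{L^p(\Omega)}\le C\,(\rho\, m_{|\alpha|})^{|\alpha|}.\qquad(*)$$ * $\mathcal B^{\{M\}}_{L^p}(\mathbb R^n)$ (respectively $\mathcal B^{(M)}_{L^p}(\mathbb R^n)$) is the set of $f\in C^\infty(\mathbb R^n)$ such that there are $C,\rho>0$ (respectively for every $\rho>0$ there is $C>0$) such that $(*)$ with $\Omega=\mathbb R^n$ holds for all multi-indices $\alpha\in\mathbb N^n$. * $\mathcal D^{\{M\}}(\mathbb R^n)$ (respectively $\mathcal D^{(M)}(\mathbb R^n)$) is the set of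 compactly supported functions in $\mathcal B^{\{M\}}_{L^\infty}(\mathbb R^n)$ (respectively $\mathcal B^{(M)}_{L^\infty}(\mathbb R^n)$). * For $U\subseteq\mathbb R^n$ open, $\mathcal E^{\{M\}}_{L^p}(U)$ (respectively $\mathcal E^{(M)}_{L^p}(U)$) is the set of $f\in C^\infty(U)$ such that for every open $\Omega$ whose closure is a compact subset of $U$ there are $C,\rho>0$ (respectively for every such $\Omega$ and every $\rho>0$ there is $C>0$) such that $(*)$ holds for all $\alpha\in\mathbb N^n$. The lacunary classes $\mathcal B^{[M]}_{L^p,(k_j)}(\mathbb R^n)$, $\mathcal D^{[M]}_{(k_j)}(\mathbb R^n)$, $\mathcal E^{[M]}_{L^p,(k_j)}(U)$ are defined in the same way, except that $(*)$ is required only for those $\alpha$ with $|\alpha|=k_j$ for some $j\ge0$. Here $[M]$ stands for either $\{M\}$ (Roumieu) or $(M)$ (Beurling). **Theorem.** Let $1\le p\le\infty$, let $(k_j)$ be a base sequence and $M$ a weight sequence such that $m_{k_{j+1}}/m_{k_j}$ is bounded. Then, in both the Roumieu and the Beurling case: (a) $\mathcal B^{[M]}_{L^p,(k_j)}(\mathbb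 R^n)=\mathcal B^{[M]}_{L^p}(\mathbb R^n)$. (b) $\mathcal D^{[M]}_{(k_j)}(\mathbb R^n)=\mathcal D^{[M]}(\mathbb R^n)$. If in addition $(k_j)$ is special and $U\subseteq\mathbb R^n$ is open, then: (c) $\mathcal E^{\{M\}}_{L^p,(k_j)}(U)=\mathcal E^{\{M\}}_{L^p}(U)$ provided that $j/m_j$ is bounded. (d) $\mathcal E^{(M)}_{L^p,(k_j)}(U)=\mathcal E^{(M)}_{L^p}(U)$ provided that $j/m_j\to0$ as $j\to\infty$. -/

import Mathlib

open Set Filter Topology MeasureTheory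
open scoped ENNReal ContDiff

noncomputable section

/-- A weight sequence: positive reals `M 0 = 1 ≤ M 1 ≤ μ 2 ≤ μ 3 ≤ ⋯`, where
`μ k = M k / M (k - 1)` (in particular `μ 1 = M 1`). -/
structure IsWeightSeq (M : ℕ → ℝ) : Prop where
  pos : ∀ k, 0 < M k
  zero : M 0 = 1
  one_le : 1 ≤ M 1
  quot_mono : ∀ k, M (k + 1) / M k ≤ M (k + 2) / M (k + 1)

/-- The sequence `m j = (M j) ^ (1 / j)`. (At `j = 0` a weight sequence gives the value `1`.) -/
def rootSeq (M : ℕ → ℝ) (j : ℕ) : ℝ := M j ^ (1 / (j : ℝ))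

/-- A base sequence: `0 = k 0 < k 1 < k 2 < ⋯`. -/
structure IsBaseSeq (k : ℕ → ℕ) : Prop where
  zero : k 0 = 0
  strictMono : StrictMono k

/-- A special base sequence: in addition `k (j + 1) / k j`, for `j ≥ 1`, is bounded. -/
structure IsSpecialBaseSeq (k : ℕ → ℕ) : Prop extends IsBaseSeq k where
  bdd : ∃ A : ℝ, ∀ j, 1 ≤ j → (k (j + 1) : ℝ) / (k j : ℝ) ≤ A

/-- The order `|α| = α_1 + ⋯ + α_n` of a multi-index. -/
def multiOrder {n : ℕ} (α : Fin n → ℕ) : ℕ := ∑ i, α i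

/-- The partial derivative `∂^α f (x)`: the derivative of order `|α|` of `f` at `x`, evaluated at
the list of vectors `e_1, …, e_1, e_2, …, e_2, …, e_n, …, e_n` in which the standard unit vector
`e_i` occurs `α_i` times. -/
def multiDeriv {𝕜 : Type*} [RCLike 𝕜] {n : ℕ} (α : Fin n → ℕ)
    (f : EuclideanSpace ℝ (Fin n) → 𝕜) (x : EuclideanSpace ℝ (Fin n)) : 𝕜 :=
  iteratedFDeriv ℝ (∑ i, α i) f x
    (fun s => EuclideanSpace.single (finSigmaFinEquiv.symm s).1 (1 : ℝ))

/-- The estimates `‖∂^α f‖_{L^p(Ω)} ≤ C (ρ m_{|α|})^{|α|}` for all multi-indices `α` whose order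
belongs to the set `S`. -/
def DCEstimates {𝕜 : Type*} [RCLike 𝕜] {n : ℕ} (p : ℝ≥0∞) (M : ℕ → ℝ) (S : Set ℕ)
    (Ω : Set (EuclideanSpace ℝ (Fin n))) (f : EuclideanSpace ℝ (Fin n) → 𝕜) (C ρ : ℝ) : Prop :=
  ∀ α : Fin n → ℕ, multiOrder α ∈ S →
    eLpNorm (multiDeriv α f) p (volume.restrict Ω) ≤
      ENNReal.ofReal (C * (ρ * rootSeq M (multiOrder α)) ^ multiOrder α)

/-- The two types of Denjoy-Carleman classes: Roumieu `{M}` and Beurling `(M)`. -/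
inductive DCType where
  | roumieu
  | beurling

/-- Quantification over the constants `C` and `ρ`: some `C, ρ > 0` in the Roumieu case; for every
`ρ > 0` some `C > 0` in the Beurling case. -/
def DCType.Constants : DCType → (ℝ → ℝ → Prop) → Prop
  | .roumieu, P => ∃ C : ℝ, 0 < C ∧ ∃ ρ : ℝ, 0 < ρ ∧ P C ρ
  | .beurling, P => ∀ ρ : ℝ, 0 < ρ → ∃ C : ℝ, 0 < C ∧ P C ρ

/-- Smooth functions on `ℝⁿ` satisfying the global estimates of type `t` for the orders in `S`. -/
def globalClassOn (𝕜 : Type*) [RCLike 𝕜] (n : ℕ) (t : DCType) (p : ℝ≥0∞) (M : ℕ → ℝ)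
    (S : Set ℕ) : Set (EuclideanSpace ℝ (Fin n) → 𝕜) :=
  {f | ContDiff ℝ ∞ f ∧ t.Constants (DCEstimates p M S univ f)}

/-- Smooth functions on `U` satisfying the local estimates of type `t` for the orders in `S`, on
every open relatively compact `Ω ⋐ U`. A function on `U` is represented by an arbitrary extension
to `ℝⁿ`: for open `U`, membership depends only on its values on `U`. -/
def localClassOn (𝕜 : Type*) [RCLike 𝕜] {n : ℕ} (t : DCType) (p : ℝ≥0∞) (M : ℕ → ℝ)
    (S : Set ℕ) (U : Set (EuclideanSpace ℝ (Fin n))) : Set (EuclideanSpace ℝ (Fin n) → 𝕜) :=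
  {f | ContDiffOn ℝ ∞ f U ∧
    ∀ Ω : Set (EuclideanSpace ℝ (Fin n)), IsOpen Ω → IsCompact (closure Ω) → closure Ω ⊆ U →
      t.Constants (DCEstimates p M S Ω f)}

/-- The global class `𝓑^{[M]}_{L^p}(ℝⁿ)`. -/
def classB (𝕜 : Type*) [RCLike 𝕜] (n : ℕ) (t : DCType) (p : ℝ≥0∞) (M : ℕ → ℝ) :
    Set (EuclideanSpace ℝ (Fin n) → 𝕜) :=
  globalClassOn 𝕜 n t p M univ

/-- The lacunary global class `𝓑^{[M]}_{L^p,(k_j)}(ℝⁿ)`. -/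
def lacunaryB (𝕜 : Type*) [RCLike 𝕜] (n : ℕ) (t : DCType) (p : ℝ≥0∞) (M : ℕ → ℝ)
    (k : ℕ → ℕ) : Set (EuclideanSpace ℝ (Fin n) → 𝕜) :=
  globalClassOn 𝕜 n t p M (range k)

/-- The class `𝓓^{[M]}(ℝⁿ)` of compactly supported elements of `𝓑^{[M]}_{L^∞}(ℝⁿ)`. -/
def classD (𝕜 : Type*) [RCLike 𝕜] (n : ℕ) (t : DCType) (M : ℕ → ℝ) :
    Set (EuclideanSpace ℝ (Fin n) → 𝕜) :=
  classB 𝕜 n t ⊤ M ∩ {f | HasCompactSupport f}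

/-- The lacunary class `𝓓^{[M]}_{(k_j)}(ℝⁿ)`. -/
def lacunaryD (𝕜 : Type*) [RCLike 𝕜] (n : ℕ) (t : DCType) (M : ℕ → ℝ) (k : ℕ → ℕ) :
    Set (EuclideanSpace ℝ (Fin n) → 𝕜) :=
  lacunaryB 𝕜 n t ⊤ M k ∩ {f | HasCompactSupport f}

/-- The local class `𝓔^{[M]}_{L^p}(U)`. -/
def classE (𝕜 : Type*) [RCLike 𝕜] {n : ℕ} (t : DCType) (p : ℝ≥0∞) (M : ℕ → ℝ)
    (U : Set (EuclideanSpace ℝ (Fin n))) : Set (EuclideanSpace ℝ (Fin n) → 𝕜) :=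
  localClassOn 𝕜 t p M univ U

/-- The lacunary local class `𝓔^{[M]}_{L^p,(k_j)}(U)`. -/
def lacunaryE (𝕜 : Type*) [RCLike 𝕜] {n : ℕ} (t : DCType) (p : ℝ≥0∞) (M : ℕ → ℝ)
    (k : ℕ → ℕ) (U : Set (EuclideanSpace ℝ (Fin n))) : Set (EuclideanSpace ℝ (Fin n) → 𝕜) :=
  localClassOn 𝕜 t p M (range k) U

end

/-!
Between consecutive orders `k j` and `k (j + 1) = k j + N` one interpolates the numbers
`Fₗ = max_{|α| = l} ‖∂^α f‖`, which at these two orders are at most `C T ^ (k j)` and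
`C T ^ (k j + N)`, with `T` a multiple of `m_{k j}`. If a weighted sum `∑ w_j P (t_j)` computes the
`i`-th derivative at `0` of every polynomial `P` of degree less than `N`, then Taylor's formula
along a line and Minkowski's inequality bound the norm of an `i`-th directional derivative by those
of the function and of its `N`-th derivative, up to translations.

On `ℝⁿ` translations cost nothing. Dividing a central difference of order about `N` by the squares
of its nodes gives a rule for the second derivative whose weights have absolute sum at most `16`,
whatever `N` is. Passing from the second to the first derivative by a two-point rule, one gets
`F_{a+1} ≤ 168 T F_a` from `F_{a+N} ≤ T ^ N F_a`, and by iteration `F_{a+i} ≤ (168 T) ^ i F_a`.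
The constant does not depend on `N`, so no growth condition on `k` is needed.

On an open set the nodes must stay close to `Ω`. The Lagrange rule with nodes spaced by `1 / T`
costs, in each coordinate, a factor `72 ^ N` and a translation by at most `N / T`. As `N ≤ D k j`
for a special base sequence, the factor is absorbed into `ρ ^ l`, `l ≥ k j`, and the translation
can be made small because `j / m_j` is bounded (enlarging `ρ`) or tends to `0`.
-/

noncomputable section

section IteratedLineDeriv

variable {E F : Type*} [NormedAddCommGroup E] [NormedSpace ℝ E] [NormedAddCommGroup F]
  [NormedSpace ℝ F] {f : E → F} {U : Set E}

/-- The iterated derivative of `f` along the vectors of a list, the head of the list being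
differentiated last. In contrast to `iteratedFDeriv`, the vectors may be permuted one swap at a
time. -/
def iteratedLineDeriv (f : E → F) : List E → E → F
  | [] => f
  | v :: l => fun x => fderiv ℝ (iteratedLineDeriv f l) x v

theorem contDiffOn_iteratedLineDeriv (hU : IsOpen U) (hf : ContDiffOn ℝ ∞ f U) (l : List E) :
    ContDiffOn ℝ ∞ (iteratedLineDeriv f l) U := by
  induction l with
  | nil => exact hf
  | cons v l ih => exact (ih.fderiv_of_isOpen hU (m := ∞) (by simp)).clm_apply contDiffOn_const

theorem iteratedLineDeriv_swap (hU : IsOpen U) (hf : ContDiffOn ℝ ∞ f U) (v w : E) (l : List E) :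
    EqOn (iteratedLineDeriv f (v :: w :: l)) (iteratedLineDeriv f (w :: v :: l)) U := by
  intro x hx
  have hg : ContDiffAt ℝ ∞ (iteratedLineDeriv f l) x :=
    (contDiffOn_iteratedLineDeriv hU hf l).contDiffAt (hU.mem_nhds hx)
  have hsymm : IsSymmSndFDerivAt ℝ (iteratedLineDeriv f l) x :=
    hg.isSymmSndFDerivAt
      (by simp only [minSmoothness_of_isRCLikeNormedField]; exact ENat.LEInfty.out)
  have hd : DifferentiableAt ℝ (fderiv ℝ (iteratedLineDeriv f l)) x :=
    (hg.fderiv_right (m := ∞) (by simp)).differentiableAt (by simp)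
  simp only [iteratedLineDeriv]
  rw [fderiv_clm_apply hd (differentiableAt_const _),
    fderiv_clm_apply hd (differentiableAt_const _)]
  simpa using hsymm _ _

theorem iteratedLineDeriv_eqOn_of_perm (hU : IsOpen U) (hf : ContDiffOn ℝ ∞ f U) {l l' : List E}
    (h : l.Perm l') : EqOn (iteratedLineDeriv f l) (iteratedLineDeriv f l') U := by
  induction h with
  | nil => exact eqOn_refl _ _
  | cons v _ ih =>
    intro x hx
    simp only [iteratedLineDeriv, (eventuallyEq_of_mem (hU.mem_nhds hx) ih).fderiv_eq]
  | swap v w l => exact iteratedLineDeriv_swap hU hf w v l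
  | trans _ _ ih₁ ih₂ => exact ih₁.trans ih₂

theorem iteratedFDeriv_eqOn_iteratedLineDeriv (hU : IsOpen U) (hf : ContDiffOn ℝ ∞ f U) (N : ℕ)
    (v : Fin N → E) :
    EqOn (fun x => iteratedFDeriv ℝ N f x v) (iteratedLineDeriv f (List.ofFn v)) U := by
  induction N with
  | zero => intro x _; simp [iteratedLineDeriv]
  | succ N ih =>
    intro x hx
    have hd : DifferentiableAt ℝ (iteratedFDeriv ℝ N f) x :=
      (hf.contDiffAt (hU.mem_nhds hx)).differentiableAt_iteratedFDeriv
        (by exact_mod_cast WithTop.coe_lt_coe.2 (ENat.natCast_lt_top N))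
    simp only [List.ofFn_succ, iteratedLineDeriv, hd.iteratedFDeriv_succ_apply_left',
      ← (eventuallyEq_of_mem (hU.mem_nhds hx) (ih fun s => v s.succ)).fderiv_eq]
    rfl

end IteratedLineDeriv

section MultiDeriv

variable {𝕜 : Type*} [RCLike 𝕜] {n : ℕ} {f : EuclideanSpace ℝ (Fin n) → 𝕜}
  {U : Set (EuclideanSpace ℝ (Fin n))}

theorem count_ofFn_fst_finSigmaFinEquiv_symm (α : Fin n → ℕ) (i : Fin n) :
    (List.ofFn fun s : Fin (∑ i, α i) => (finSigmaFinEquiv.symm s).1).count i = α i := by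
  rw [← Multiset.coe_count, ← Fin.univ_val_map, Multiset.count_map, ← Finset.filter_val,
    Finset.card_val]
  simp only [eq_comm (a := i)]
  rw [← Fintype.card_subtype, Fintype.card_congr (((finSigmaFinEquiv.symm).subtypeEquiv
    fun _ => Iff.rfl).trans (Equiv.sigmaSubtype (β := fun j => Fin (α j)) i)), Fintype.card_fin]

theorem multiDeriv_eqOn_iteratedLineDeriv (hU : IsOpen U) (hf : ContDiffOn ℝ ∞ f U)
    {α : Fin n → ℕ} {l : List (Fin n)} (hl : ∀ i, l.count i = α i) :
    EqOn (multiDeriv α f)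
      (iteratedLineDeriv f (l.map fun i => EuclideanSpace.single i (1 : ℝ))) U := by
  refine (iteratedFDeriv_eqOn_iteratedLineDeriv hU hf _ _).trans
    (iteratedLineDeriv_eqOn_of_perm hU hf ?_)
  change (List.ofFn ((fun i => EuclideanSpace.single i (1 : ℝ)) ∘
    fun s : Fin (∑ i, α i) => (finSigmaFinEquiv.symm s).1)).Perm _
  rw [← List.map_ofFn]
  exact (List.perm_iff_count.2 fun i => by
    rw [hl, count_ofFn_fst_finSigmaFinEquiv_symm]).map _

theorem contDiffOn_multiDeriv (hU : IsOpen U) (hf : ContDiffOn ℝ ∞ f U) (α : Fin n → ℕ) :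
    ContDiffOn ℝ ∞ (multiDeriv α f) U :=
  (contDiffOn_iteratedLineDeriv hU hf _).congr
    (multiDeriv_eqOn_iteratedLineDeriv hU hf (count_ofFn_fst_finSigmaFinEquiv_symm α))

theorem hasLineDerivAt_multiDeriv (hU : IsOpen U) (hf : ContDiffOn ℝ ∞ f U) (α : Fin n → ℕ)
    (i : Fin n) {x : EuclideanSpace ℝ (Fin n)} (hx : x ∈ U) :
    HasLineDerivAt ℝ (multiDeriv α f) (multiDeriv (α + Pi.single i 1) f x) x
      (EuclideanSpace.single i 1) := by
  obtain ⟨l, hl⟩ : ∃ l : List (Fin n), ∀ j, l.count j = α j :=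
    ⟨_, count_ofFn_fst_finSigmaFinEquiv_symm α⟩
  have hil (j : Fin n) : (i :: l).count j = (α + Pi.single i 1 : Fin n → ℕ) j := by
    rw [List.count_cons, hl]
    simp [Pi.single_apply, eq_comm (a := j)]
  have hα := eventuallyEq_of_mem (hU.mem_nhds hx) (multiDeriv_eqOn_iteratedLineDeriv hU hf hl)
  have hdiff := ((contDiffOn_multiDeriv hU hf α).contDiffAt (hU.mem_nhds hx)).differentiableAt
    (by simp)
  have hderiv := hdiff.hasFDerivAt.hasLineDerivAt (EuclideanSpace.single i 1)
  rw [hα.fderiv_eq] at hderiv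
  exact (multiDeriv_eqOn_iteratedLineDeriv hU hf hil hx).symm ▸ hderiv

end MultiDeriv

section Minkowski

variable {X Y : Type*} [MeasurableSpace X] [MeasurableSpace Y] {μ : Measure X} {ν : Measure Y}

theorem rpow_lintegral_le {g : Y → ℝ≥0∞} (hg : AEMeasurable g ν) {r : ℝ} (hr : 1 ≤ r) :
    (∫⁻ y, g y ∂ν) ^ r ≤ ν univ ^ (r - 1) * ∫⁻ y, g y ^ r ∂ν := by
  have hr0 : 0 < r := one_pos.trans_le hr
  have hle := eLpNorm'_le_eLpNorm'_mul_rpow_measure_univ one_pos hr hg.aestronglyMeasurable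
  simp only [eLpNorm', enorm_eq_self, ENNReal.rpow_one, div_one] at hle
  refine (ENNReal.rpow_le_rpow hle hr0.le).trans_eq ?_
  rw [ENNReal.mul_rpow_of_nonneg _ _ hr0.le, ← ENNReal.rpow_mul, ← ENNReal.rpow_mul,
    one_div_mul_cancel hr0.ne', ENNReal.rpow_one, mul_comm, sub_mul, one_mul,
    one_div_mul_cancel hr0.ne']

theorem eLpNorm_top_lintegral_le [SFinite μ] [SFinite ν] {f : X → Y → ℝ≥0∞}
    (hf : Measurable f.uncurry) {S : ℝ≥0∞} (hS : ∀ y, eLpNorm (fun x => f x y) ⊤ μ ≤ S) :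
    eLpNorm (fun x => ∫⁻ y, f x y ∂ν) ⊤ μ ≤ ν univ * S := by
  have hae : ∀ᵐ y ∂ν, ∀ᵐ x ∂μ, f x y ≤ S := ae_of_all _ fun y =>
    (enorm_ae_le_eLpNormEssSup (fun x => f x y) μ).mono fun x hx => hx.trans (hS y)
  have hmeas : MeasurableSet {z : X × Y | f z.1 z.2 ≤ S} := measurableSet_le hf measurable_const
  have hae' : ∀ᵐ x ∂μ, ∀ᵐ y ∂ν, f x y ≤ S := (Measure.ae_ae_comm hmeas).2 hae
  rw [eLpNorm_exponent_top]
  refine essSup_le_of_ae_le _ (hae'.mono fun x hx => ?_)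
  exact (lintegral_mono_ae hx).trans_eq (by rw [lintegral_const, mul_comm])

theorem lintegral_rpow_lintegral_le [SFinite μ] [IsFiniteMeasure ν] {f : X → Y → ℝ≥0∞}
    (hf : Measurable f.uncurry) {r : ℝ} (hr : 1 ≤ r) {S : ℝ≥0∞}
    (hS : ∀ y, ∫⁻ x, f x y ^ r ∂μ ≤ S ^ r) :
    ∫⁻ x, (∫⁻ y, f x y ∂ν) ^ r ∂μ ≤ (ν univ * S) ^ r := by
  have hr0 : 0 ≤ r - 1 := sub_nonneg.2 hr
  calc ∫⁻ x, (∫⁻ y, f x y ∂ν) ^ r ∂μ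
      ≤ ∫⁻ x, ν univ ^ (r - 1) * ∫⁻ y, f x y ^ r ∂ν ∂μ :=
        lintegral_mono fun x => rpow_lintegral_le hf.of_uncurry_left.aemeasurable hr
    _ = ν univ ^ (r - 1) * ∫⁻ y, ∫⁻ x, f x y ^ r ∂μ ∂ν := by
        rw [lintegral_const_mul' _ _ (ENNReal.rpow_ne_top_of_nonneg hr0 (measure_ne_top ν univ)),
          lintegral_lintegral_swap (hf.pow_const r).aemeasurable]
    _ ≤ ν univ ^ (r - 1) * ∫⁻ _, S ^ r ∂ν := by gcongr with y; exact hS y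
    _ = (ν univ * S) ^ r := by
        rw [lintegral_const, mul_comm (S ^ r), ← mul_assoc,
          ENNReal.mul_rpow_of_nonneg _ _ (by linarith)]
        nth_rewrite 2 [← ENNReal.rpow_one (ν univ)]
        rw [← ENNReal.rpow_add_of_nonneg _ _ hr0 zero_le_one, sub_add_cancel]

theorem eLpNorm_lintegral_le [SFinite μ] [IsFiniteMeasure ν] {f : X → Y → ℝ≥0∞}
    (hf : Measurable f.uncurry) {p : ℝ≥0∞} (hp : 1 ≤ p) {S : ℝ≥0∞}
    (hS : ∀ y, eLpNorm (fun x => f x y) p μ ≤ S) :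
    eLpNorm (fun x => ∫⁻ y, f x y ∂ν) p μ ≤ ν univ * S := by
  rcases eq_or_ne p ⊤ with rfl | hp_top
  · exact eLpNorm_top_lintegral_le hf hS
  have hp0 : p ≠ 0 := (zero_lt_one.trans_le hp).ne'
  have hr : 1 ≤ p.toReal := by simpa using ENNReal.toReal_mono hp_top hp
  have hr0 : 0 < p.toReal := one_pos.trans_le hr
  simp only [eLpNorm_eq_lintegral_rpow_enorm_toReal hp0 hp_top, enorm_eq_self, one_div,
    ENNReal.rpow_inv_le_iff hr0] at hS ⊢
  exact lintegral_rpow_lintegral_le hf hr hS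

theorem eLpNorm_const_mul_le {g : X → ℝ≥0∞} (hg : Measurable g) (p : ℝ≥0∞) (c : ℝ≥0∞) :
    eLpNorm (fun x => c * g x) p μ ≤ c * eLpNorm g p μ :=
  eLpNorm_le_mul_eLpNorm_of_ae_le_mul'' p hg.aestronglyMeasurable
    (ae_of_all _ fun x => by simp only [enorm_eq_self, le_refl])

end Minkowski

section Translates

variable {E : Type*} [NormedAddCommGroup E] [MeasurableSpace E] [BorelSpace E] {μ : Measure E}
  [μ.IsAddRightInvariant]

theorem eLpNorm_translate {g : E → ℝ≥0∞} (hg : Measurable g) (p : ℝ≥0∞) (y : E) :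
    eLpNorm (fun x => g (x + y)) p μ = eLpNorm g p μ :=
  eLpNorm_comp_measurePreserving hg.aestronglyMeasurable (measurePreserving_add_right μ y)

variable [NormedSpace ℝ E] [SecondCountableTopology E] [SFinite μ]

theorem eLpNorm_lintegral_translate_le {g : E → ℝ≥0∞} (hg : Measurable g) {p : ℝ≥0∞} (hp : 1 ≤ p)
    (v : E) (τ : ℝ) :
    eLpNorm (fun x => ∫⁻ u in Icc (-τ) τ, g (x + u • v)) p μ ≤
      ENNReal.ofReal (2 * τ) * eLpNorm g p μ := by
  have hmeas : Measurable (Function.uncurry fun (x : E) (u : ℝ) => g (x + u • v)) := by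
    simp only [Function.uncurry_def]; fun_prop
  refine (eLpNorm_lintegral_le hmeas hp fun u => (eLpNorm_translate hg p (u • v)).le).trans_eq ?_
  rw [Measure.restrict_apply_univ, Real.volume_Icc, sub_neg_eq_add, two_mul]

theorem eLpNorm_sum_translate_add_lintegral_le {g h : E → ℝ≥0∞} (hg : Measurable g)
    (hh : Measurable h) {p : ℝ≥0∞} (hp : 1 ≤ p) {ι : Type*} (J : Finset ι) (a : ι → ℝ≥0∞)
    (t : ι → ℝ) (c : ℝ≥0∞) (v : E) (τ : ℝ) :
    eLpNorm (fun x => ∑ j ∈ J, a j * g (x + t j • v) + c * ∫⁻ u in Icc (-τ) τ, h (x + u • v)) p μ ≤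
      (∑ j ∈ J, a j) * eLpNorm g p μ + c * (ENNReal.ofReal (2 * τ) * eLpNorm h p μ) := by
  have hgm (j : ι) : Measurable fun x => g (x + t j • v) := by fun_prop
  have hhm : Measurable fun x => ∫⁻ u in Icc (-τ) τ, h (x + u • v) :=
    Measurable.lintegral_prod_right' (f := fun z : E × ℝ => h (z.1 + z.2 • v)) (by fun_prop)
  have hsum : eLpNorm (fun x => ∑ j ∈ J, a j * g (x + t j • v)) p μ ≤
      (∑ j ∈ J, a j) * eLpNorm g p μ := by
    have hle := eLpNorm_sum_le (s := J) (f := fun j x => a j * g (x + t j • v)) (μ := μ)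
      (fun j _ => ((hgm j).const_mul _).aestronglyMeasurable) hp
    rw [Finset.sum_mul]
    refine (le_of_eq_of_le (by congr 1; ext; simp) hle).trans (Finset.sum_le_sum fun j _ => ?_)
    rw [← eLpNorm_translate hg p (t j • v)]
    exact eLpNorm_const_mul_le (hgm j) p _
  refine (eLpNorm_add_le (Finset.measurable_fun_sum J fun j _ =>
    (hgm j).const_mul _).aestronglyMeasurable (hhm.const_mul _).aestronglyMeasurable hp).trans ?_
  gcongr
  exact (eLpNorm_const_mul_le hhm p c).trans
    (by gcongr; exact eLpNorm_lintegral_translate_le hh hp v τ)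

end Translates

section Taylor

variable {G : Type*} [NormedAddCommGroup G] [NormedSpace ℝ G]

theorem hasDerivAt_sum_taylor {g : ℕ → ℝ → G} {u : ℝ}
    (hg : ∀ s, HasDerivAt (g s) (g (s + 1) u) u) (t : ℝ) (m : ℕ) :
    HasDerivAt (fun u => ∑ s ∈ Finset.range (m + 1), ((t - u) ^ s / (s.factorial : ℝ)) • g s u)
      (((t - u) ^ m / (m.factorial : ℝ)) • g (m + 1) u) u := by
  induction m with
  | zero => simpa using hg 0
  | succ m ih =>
    simp_rw [Finset.sum_range_succ _ (m + 1)]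
    have hpow : HasDerivAt (fun u : ℝ => (t - u) ^ (m + 1) / ((m + 1).factorial : ℝ))
        (-((t - u) ^ m / (m.factorial : ℝ))) u := by
      refine ((((hasDerivAt_id u).const_sub t).pow (m + 1)).div_const _).congr_deriv ?_
      have : (m.factorial : ℝ) ≠ 0 := by positivity
      simp only [id, Nat.factorial_succ]
      push_cast
      field_simp
    refine (ih.add (hpow.smul (hg (m + 1)))).congr_deriv ?_
    rw [neg_smul]
    abel

theorem sub_sum_taylor_eq_integral [CompleteSpace G] {g : ℕ → ℝ → G} {t : ℝ}
    (hg : ∀ s, ∀ u ∈ uIcc 0 t, HasDerivAt (g s) (g (s + 1) u) u) (m : ℕ) :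
    g 0 t - ∑ s ∈ Finset.range (m + 1), (t ^ s / (s.factorial : ℝ)) • g s 0 =
      ∫ u in (0)..t, ((t - u) ^ m / (m.factorial : ℝ)) • g (m + 1) u := by
  have hcont : ContinuousOn (fun u => ((t - u) ^ m / (m.factorial : ℝ)) • g (m + 1) u)
      (uIcc 0 t) :=
    ContinuousOn.smul (by fun_prop) fun u hu =>
      (hg (m + 1) u hu).continuousAt.continuousWithinAt
  have hend : ∑ s ∈ Finset.range (m + 1), ((t - t) ^ s / (s.factorial : ℝ)) • g s t = g 0 t := by
    rw [Finset.sum_range_succ']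
    simp
  rw [intervalIntegral.integral_eq_sub_of_hasDerivAt
    (fun u hu => hasDerivAt_sum_taylor (fun s => hg s u hu) t m) hcont.intervalIntegrable, hend]
  simp only [sub_zero]

theorem enorm_sub_sum_taylor_le [CompleteSpace G] {g : ℕ → ℝ → G} {τ t : ℝ} (ht : |t| ≤ τ)
    (hg : ∀ s, ∀ u ∈ Icc (-τ) τ, HasDerivAt (g s) (g (s + 1) u) u) (m : ℕ) :
    ‖g 0 t - ∑ s ∈ Finset.range (m + 1), (t ^ s / (s.factorial : ℝ)) • g s 0‖ₑ ≤
      ENNReal.ofReal (τ ^ m / (m.factorial : ℝ)) * ∫⁻ u in Icc (-τ) τ, ‖g (m + 1) u‖ₑ := by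
  have hτ : 0 ≤ τ := (abs_nonneg t).trans ht
  have hsub : uIcc 0 t ⊆ Icc (-τ) τ := uIcc_subset_Icc ⟨by linarith, hτ⟩ (abs_le.1 ht)
  have hpow (u : ℝ) (hu : u ∈ uIoc 0 t) :
      ‖(t - u) ^ m / (m.factorial : ℝ)‖ₑ ≤ ENNReal.ofReal (τ ^ m / (m.factorial : ℝ)) := by
    have hut : |t - u| ≤ τ := by
      simpa only [sub_zero] using
        (abs_sub_right_of_mem_uIcc (uIoc_subset_uIcc hu)).trans (by rwa [sub_zero])
    rw [Real.enorm_eq_ofReal_abs, abs_div, abs_pow, Nat.abs_cast]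
    gcongr
  rw [sub_sum_taylor_eq_integral (fun s u hu => hg s u (hsub hu)) m, ← ofReal_norm,
    intervalIntegral.norm_intervalIntegral_eq, ofReal_norm,
    ← lintegral_const_mul' _ _ ENNReal.ofReal_ne_top]
  refine (enorm_integral_le_lintegral_enorm _).trans
    ((setLIntegral_mono' measurableSet_uIoc fun u hu => ?_).trans
      (lintegral_mono_set (uIoc_subset_uIcc.trans hsub)))
  rw [enorm_smul]
  gcongr
  exact hpow u hu

end Taylor

section DifferentiationRule

variable {ι : Type*} {J : Finset ι} {w t : ι → ℝ} {i m : ℕ}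

/-- The finite sum `∑ j ∈ J, w j * P (t j)` computes the `i`-th derivative at `0` of every
polynomial `P` of degree at most `m`; it is enough to require this for the monomials. -/
def IsDifferentiationRule (J : Finset ι) (w t : ι → ℝ) (i m : ℕ) : Prop :=
  ∀ s ≤ m, ∑ j ∈ J, w j * t j ^ s = if s = i then (i.factorial : ℝ) else 0

theorem IsDifferentiationRule.mono {m' : ℕ} (hw : IsDifferentiationRule J w t i m') (h : m ≤ m') :
    IsDifferentiationRule J w t i m :=
  fun s hs => hw s (hs.trans h)

theorem IsDifferentiationRule.sum_smul_sum_taylor {G : Type*} [AddCommGroup G] [Module ℝ G]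
    (hw : IsDifferentiationRule J w t i m) (hi : i ≤ m) (c : ℕ → G) :
    ∑ j ∈ J, w j • ∑ s ∈ Finset.range (m + 1), (t j ^ s / (s.factorial : ℝ)) • c s = c i := by
  have hcoeff (s : ℕ) (hs : s ∈ Finset.range (m + 1)) :
      (∑ j ∈ J, w j * (t j ^ s / (s.factorial : ℝ))) • c s = if s = i then c i else 0 := by
    simp_rw [← mul_div_assoc]
    rw [← Finset.sum_div, hw s (Finset.mem_range_succ_iff.1 hs)]
    split_ifs with h
    · rw [h, div_self (by positivity), one_smul]
    · rw [zero_div, zero_smul]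
  simp only [Finset.smul_sum, smul_smul]
  rw [Finset.sum_comm]
  simp only [← Finset.sum_smul]
  rw [Finset.sum_congr rfl hcoeff, Finset.sum_ite_eq', if_pos (Finset.mem_range_succ_iff.2 hi)]

theorem IsDifferentiationRule.enorm_le {G : Type*} [NormedAddCommGroup G] [NormedSpace ℝ G]
    [CompleteSpace G] (hw : IsDifferentiationRule J w t i m) (hi : i ≤ m) {τ : ℝ}
    (ht : ∀ j ∈ J, |t j| ≤ τ) {g : ℕ → ℝ → G}
    (hg : ∀ s, ∀ u ∈ Icc (-τ) τ, HasDerivAt (g s) (g (s + 1) u) u) :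
    ‖g i 0‖ₑ ≤ ∑ j ∈ J, ‖w j‖ₑ * ‖g 0 (t j)‖ₑ + (∑ j ∈ J, ‖w j‖ₑ) *
      ENNReal.ofReal (τ ^ m / (m.factorial : ℝ)) * ∫⁻ u in Icc (-τ) τ, ‖g (m + 1) u‖ₑ := by
  set P : ι → G := fun j =>
    ∑ s ∈ Finset.range (m + 1), (t j ^ s / (s.factorial : ℝ)) • g s 0
  set R := ENNReal.ofReal (τ ^ m / (m.factorial : ℝ)) * ∫⁻ u in Icc (-τ) τ, ‖g (m + 1) u‖ₑ with hR
  have hPj (j : ι) (hj : j ∈ J) : ‖P j‖ₑ ≤ ‖g 0 (t j)‖ₑ + R := by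
    calc ‖P j‖ₑ = ‖g 0 (t j) - (g 0 (t j) - P j)‖ₑ := by rw [sub_sub_cancel]
      _ ≤ ‖g 0 (t j)‖ₑ + ‖g 0 (t j) - P j‖ₑ := enorm_sub_le
      _ ≤ ‖g 0 (t j)‖ₑ + R := by gcongr; exact enorm_sub_sum_taylor_le (ht j hj) hg m
  calc ‖g i 0‖ₑ = ‖∑ j ∈ J, w j • P j‖ₑ := by rw [hw.sum_smul_sum_taylor hi fun s => g s 0]
    _ ≤ ∑ j ∈ J, ‖w j‖ₑ * ‖P j‖ₑ := (enorm_sum_le _ _).trans_eq (by simp only [enorm_smul])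
    _ ≤ ∑ j ∈ J, ‖w j‖ₑ * (‖g 0 (t j)‖ₑ + R) := by gcongr with j hj; exact hPj j hj
    _ = _ := by simp only [mul_add, Finset.sum_add_distrib, Finset.sum_mul, mul_assoc, hR]

end DifferentiationRule

section LineDerivSeq

variable {E : Type*} [NormedAddCommGroup E] [NormedSpace ℝ E]
  {G : Type*} [NormedAddCommGroup G] [NormedSpace ℝ G] {v : E} {F : ℕ → E → G} {Ω Ω' : Set E}

/-- The functions `F 0, F 1, F 2, …` are continuous on `Ω`, and there each of them is the
derivative of the preceding one in the direction `v`. Working with such sequences, rather than with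
`F 0` and its iterated derivatives, makes every tail of a sequence again a sequence of this kind. -/
structure IsLineDerivSeqOn (v : E) (F : ℕ → E → G) (Ω : Set E) : Prop where
  continuousOn : ∀ s, ContinuousOn (F s) Ω
  hasLineDerivAt : ∀ s, ∀ x ∈ Ω, HasLineDerivAt ℝ (F s) (F (s + 1) x) x v

theorem IsLineDerivSeqOn.mono (hF : IsLineDerivSeqOn v F Ω') (h : Ω ⊆ Ω') :
    IsLineDerivSeqOn v F Ω :=
  ⟨fun s => (hF.continuousOn s).mono h, fun s x hx => hF.hasLineDerivAt s x (h hx)⟩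

theorem IsLineDerivSeqOn.hasDerivAt (hF : IsLineDerivSeqOn v F Ω) (s : ℕ) {x : E} {u : ℝ}
    (hx : x + u • v ∈ Ω) :
    HasDerivAt (fun u : ℝ => F s (x + u • v)) (F (s + 1) (x + u • v)) u := by
  have h := hF.hasLineDerivAt s _ hx
  rw [HasLineDerivAt, ← sub_self u] at h
  refine (h.comp_sub_const u u).congr_of_eventuallyEq (.of_eq (funext fun z => ?_))
  rw [add_assoc, ← add_smul, add_sub_cancel]

theorem IsLineDerivSeqOn.rescale (hF : IsLineDerivSeqOn v F Ω) (ε : ℝ) :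
    IsLineDerivSeqOn (ε • v) (fun s => ε ^ s • F s) Ω where
  continuousOn s := (hF.continuousOn s).const_smul _
  hasLineDerivAt s x hx := by
    have h := ((hF.hasLineDerivAt s x hx).smul ε).const_smul (ε ^ s)
    rwa [smul_smul, ← pow_succ] at h

variable [MeasurableSpace E] [BorelSpace E]

theorem IsLineDerivSeqOn.measurable_indicator_enorm (hF : IsLineDerivSeqOn v F Ω)
    (hΩ : MeasurableSet Ω) (s : ℕ) : Measurable (Ω.indicator fun x => ‖F s x‖ₑ) := by
  classical
  rw [← piecewise_eq_indicator]
  exact (hF.continuousOn s).enorm.measurable_piecewise continuousOn_const hΩ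

variable [SecondCountableTopology E] [CompleteSpace G]
  {μ : Measure E} [SFinite μ] [μ.IsAddRightInvariant] {p : ℝ≥0∞}
  {ι : Type*} {J : Finset ι} {w t : ι → ℝ} {i m : ℕ} {τ W ε : ℝ}

theorem IsDifferentiationRule.eLpNorm_lineDeriv_le_of_unit_step
    (hw : IsDifferentiationRule J w t i m) (hi : i ≤ m) (ht : ∀ j ∈ J, |t j| ≤ τ)
    (hp : 1 ≤ p) (hΩ : MeasurableSet Ω) (hΩ' : MeasurableSet Ω') (hF : IsLineDerivSeqOn v F Ω')
    (hsub : ∀ x ∈ Ω, ∀ u : ℝ, |u| ≤ τ → x + u • v ∈ Ω') :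
    eLpNorm (F i) p (μ.restrict Ω) ≤ (∑ j ∈ J, ‖w j‖ₑ) * (eLpNorm (F 0) p (μ.restrict Ω') +
      ENNReal.ofReal (τ ^ m / (m.factorial : ℝ)) * (ENNReal.ofReal (2 * τ) *
        eLpNorm (F (m + 1)) p (μ.restrict Ω'))) := by
  set g : ℕ → E → ℝ≥0∞ := fun s => Ω'.indicator fun x => ‖F s x‖ₑ with hg
  have hgm (s : ℕ) : Measurable (g s) := hF.measurable_indicator_enorm hΩ' s
  have hgF (s : ℕ) : eLpNorm (g s) p μ = eLpNorm (F s) p (μ.restrict Ω') := by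
    rw [hg, eLpNorm_indicator_eq_eLpNorm_restrict hΩ']
    exact eLpNorm_enorm _
  have hgx (s : ℕ) {x : E} (hx : x ∈ Ω) {u : ℝ} (hu : |u| ≤ τ) :
      ‖F s (x + u • v)‖ₑ = g s (x + u • v) :=
    (indicator_of_mem (hsub x hx u hu) fun x => ‖F s x‖ₑ).symm
  have hpt (x : E) (hx : x ∈ Ω) : ‖F i x‖ₑ ≤ ∑ j ∈ J, ‖w j‖ₑ * g 0 (x + t j • v) +
      (∑ j ∈ J, ‖w j‖ₑ) * ENNReal.ofReal (τ ^ m / (m.factorial : ℝ)) *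
        ∫⁻ u in Icc (-τ) τ, g (m + 1) (x + u • v) := by
    have h := hw.enorm_le hi ht (g := fun s u => F s (x + u • v)) fun s u hu =>
      hF.hasDerivAt s (hsub x hx u (abs_le.2 hu))
    rw [zero_smul, add_zero, Finset.sum_congr rfl fun j hj => by rw [hgx 0 hx (ht j hj)],
      setLIntegral_congr_fun measurableSet_Icc fun u hu => hgx (m + 1) hx (abs_le.2 hu)] at h
    exact h
  refine (eLpNorm_mono_enorm_ae ((ae_restrict_iff' hΩ).2 (ae_of_all _ hpt))).trans
    ((eLpNorm_restrict_le _ _ _ _).trans ((eLpNorm_sum_translate_add_lintegral_le (hgm 0)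
      (hgm (m + 1)) hp J _ t _ v τ).trans_eq ?_))
  rw [hgF, hgF, mul_assoc, mul_add]

theorem IsDifferentiationRule.eLpNorm_lineDeriv_le (hw : IsDifferentiationRule J w t i m)
    (hi : i ≤ m) (ht : ∀ j ∈ J, |t j| ≤ τ) (hW : ∑ j ∈ J, |w j| ≤ W) (hτ : 0 ≤ τ) (hε : 0 < ε)
    (hp : 1 ≤ p) (hΩ : MeasurableSet Ω) (hΩ' : MeasurableSet Ω') (hF : IsLineDerivSeqOn v F Ω')
    (hsub : ∀ x ∈ Ω, ∀ u : ℝ, |u| ≤ ε * τ → x + u • v ∈ Ω') :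
    eLpNorm (F i) p (μ.restrict Ω) ≤ ENNReal.ofReal (W / ε ^ i) *
      (eLpNorm (F 0) p (μ.restrict Ω') +
        ENNReal.ofReal (2 * (ε * τ) ^ (m + 1) / (m.factorial : ℝ)) *
          eLpNorm (F (m + 1)) p (μ.restrict Ω')) := by
  have hsub' : ∀ x ∈ Ω, ∀ u : ℝ, |u| ≤ τ → x + u • ε • v ∈ Ω' := fun x hx u hu => by
    rw [smul_smul]
    refine hsub x hx _ ?_
    rw [abs_mul, abs_of_pos hε, mul_comm]
    gcongr
  have h := hw.eLpNorm_lineDeriv_le_of_unit_step (μ := μ) hi ht hp hΩ hΩ' (hF.rescale ε) hsub'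
  have hsmul (s : ℕ) (Ω : Set E) : eLpNorm (ε ^ s • F s) p (μ.restrict Ω) =
      ENNReal.ofReal (ε ^ s) * eLpNorm (F s) p (μ.restrict Ω) := by
    rw [eLpNorm_const_smul, Real.enorm_of_nonneg (by positivity)]
  have hsum : ∑ j ∈ J, ‖w j‖ₑ ≤ ENNReal.ofReal W := by
    simp only [Real.enorm_eq_ofReal_abs]
    rw [← ENNReal.ofReal_sum_of_nonneg fun _ _ => abs_nonneg _]
    exact ENNReal.ofReal_le_ofReal hW
  have hconst : ENNReal.ofReal (τ ^ m / (m.factorial : ℝ)) * (ENNReal.ofReal (2 * τ) *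
      ENNReal.ofReal (ε ^ (m + 1))) =
        ENNReal.ofReal (2 * (ε * τ) ^ (m + 1) / (m.factorial : ℝ)) := by
    rw [← ENNReal.ofReal_mul (by positivity), ← ENNReal.ofReal_mul (by positivity)]
    ring_nf
  rw [hsmul, hsmul, hsmul, pow_zero, ENNReal.ofReal_one, one_mul,
    ← mul_assoc (ENNReal.ofReal (2 * τ)), ← mul_assoc (ENNReal.ofReal (τ ^ m / _)), hconst] at h
  rw [ENNReal.ofReal_div_of_pos (by positivity), ENNReal.div_eq_inv_mul, mul_assoc,
    ← ENNReal.mul_le_iff_le_inv (by simpa using pow_pos hε i) ENNReal.ofReal_ne_top]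
  exact h.trans (by gcongr)

end LineDerivSeq

section SecondDerivative

/-- The coefficients of the central difference of order `2 * N`, normalized so that the central one,
at `j = N`, equals `1`. -/
def centralDiffCoeff (N j : ℕ) : ℝ := (-1) ^ (N + j) * (2 * N).choose j / (2 * N).choose N

/-- The weights at the nodes `j - N`, `0 ≤ j ≤ 2 * N`, of a rule for the second derivative at `0`:
in the central difference of `P x / x ^ 2` the central term is replaced by the one which makes the
rule vanish on constants. (At `j = N` the quotient by `(j - N) ^ 2` is `0`.) -/
def secondDerivWeight (N j : ℕ) : ℝ :=
  -2 * (centralDiffCoeff N j / ((j : ℝ) - N) ^ 2) + if j = N then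
    2 * ∑ l ∈ Finset.range (2 * N + 1), centralDiffCoeff N l / ((l : ℝ) - N) ^ 2 else 0

variable (N : ℕ)

theorem centralDiffCoeff_self : centralDiffCoeff N N = 1 := by
  have : ((2 * N).choose N : ℝ) ≠ 0 := by exact_mod_cast N.centralBinom_ne_zero
  rw [centralDiffCoeff, (Even.add_self N).neg_one_pow, one_mul, div_self this]

theorem abs_centralDiffCoeff_le_one (j : ℕ) : |centralDiffCoeff N j| ≤ 1 := by
  simp only [centralDiffCoeff, abs_div, abs_mul, abs_pow, abs_neg, abs_one, one_pow, one_mul,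
    Nat.abs_cast]
  exact div_le_one_of_le₀ (by exact_mod_cast j.choose_le_centralBinom N) (Nat.cast_nonneg _)

theorem centralDiffCoeff_sub {j : ℕ} (hj : j ≤ 2 * N) :
    centralDiffCoeff N (2 * N - j) = centralDiffCoeff N j := by
  rw [centralDiffCoeff, centralDiffCoeff, Nat.choose_symm hj,
    neg_one_pow_congr (m := N + (2 * N - j)) (n := N + j) (by grind)]

theorem sum_centralDiffCoeff_mul_pow {q : ℕ} (hq : q < 2 * N) :
    ∑ j ∈ Finset.range (2 * N + 1), centralDiffCoeff N j * ((j : ℝ) - N) ^ q = 0 := by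
  have h := congrFun (fwdDiff_iter_pow_eq_zero_of_lt (R := ℝ) hq) (-(N : ℝ))
  rw [fwdDiff_iter_eq_sum_shift, Pi.zero_apply] at h
  have hterm (j : ℕ) (hj : j ∈ Finset.range (2 * N + 1)) :
      centralDiffCoeff N j * ((j : ℝ) - N) ^ q = (-1) ^ N / (2 * N).choose N *
        (((-1 : ℤ) ^ (2 * N - j) * (2 * N).choose j) • (-(N : ℝ) + j • (1 : ℝ)) ^ q) := by
    have hj := Finset.mem_range_succ_iff.1 hj
    rw [centralDiffCoeff, neg_one_pow_congr (m := 2 * N - j) (n := j) (by grind), zsmul_eq_mul,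
      nsmul_eq_mul, mul_one, neg_add_eq_sub, pow_add]
    push_cast
    ring
  rw [Finset.sum_congr rfl hterm, ← Finset.mul_sum, h, mul_zero]

theorem sum_range_inv_sq_le_two : ∑ j ∈ Finset.range N, (((j : ℝ) + 1) ^ 2)⁻¹ ≤ 2 := by
  have h := sum_Ioo_inv_sq_le (α := ℝ) 0 (N + 1)
  rw [show Finset.Ioo 0 (N + 1) = Finset.Ico (0 + 1) (N + 1) from rfl, ← Finset.sum_Ico_add',
    ← Finset.range_eq_Ico] at h
  simpa using h

theorem sum_inv_sq_sub_le_four :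
    ∑ j ∈ Finset.range (2 * N + 1), (((j : ℝ) - N) ^ 2)⁻¹ ≤ 4 := by
  have hleft : ∑ j ∈ Finset.range N, (((j : ℝ) - N) ^ 2)⁻¹ ≤ 2 := by
    refine (Finset.sum_range_reflect _ N).symm.trans_le
      ((Finset.sum_congr rfl fun j hj => ?_).trans_le (sum_range_inv_sq_le_two N))
    have hj := Finset.mem_range.1 hj
    rw [Nat.sub_sub, Nat.cast_sub (by omega), sub_sub_cancel_left, neg_sq]
    push_cast
    rw [add_comm]
  have hright : ∑ j ∈ Finset.range N, (((N + (j + 1) : ℕ) - N : ℝ) ^ 2)⁻¹ ≤ 2 := by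
    simpa using sum_range_inv_sq_le_two N
  rw [show 2 * N + 1 = N + (N + 1) by ring, Finset.sum_range_add, Finset.sum_range_succ' _ N,
    add_zero, sub_self, zero_pow two_ne_zero, inv_zero]
  linarith

theorem sum_abs_secondDerivWeight_le :
    ∑ j ∈ Finset.range (2 * N + 1), |secondDerivWeight N j| ≤ 16 := by
  have habs : ∑ j ∈ Finset.range (2 * N + 1), |centralDiffCoeff N j / ((j : ℝ) - N) ^ 2| ≤ 4 := by
    refine (Finset.sum_le_sum fun j _ => ?_).trans (sum_inv_sq_sub_le_four N)
    rw [abs_div, abs_of_nonneg (sq_nonneg ((j : ℝ) - N)), div_eq_mul_inv]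
    exact mul_le_of_le_one_left (by positivity) (abs_centralDiffCoeff_le_one N j)
  set D := ∑ j ∈ Finset.range (2 * N + 1), centralDiffCoeff N j / ((j : ℝ) - N) ^ 2 with hD
  have hDabs : |D| ≤ 4 := (Finset.abs_sum_le_sum_abs _ _).trans habs
  calc ∑ j ∈ Finset.range (2 * N + 1), |secondDerivWeight N j|
      ≤ ∑ j ∈ Finset.range (2 * N + 1), (2 * |centralDiffCoeff N j / ((j : ℝ) - N) ^ 2| +
          if j = N then 2 * |D| else 0) := by
        refine Finset.sum_le_sum fun j _ => (abs_add_le _ _).trans ?_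
        rw [abs_mul, ← hD]
        split_ifs <;> simp [abs_mul]
    _ = 2 * ∑ j ∈ Finset.range (2 * N + 1), |centralDiffCoeff N j / ((j : ℝ) - N) ^ 2| +
          2 * |D| := by
        rw [Finset.sum_add_distrib, ← Finset.mul_sum, Finset.sum_ite_eq',
          if_pos (Finset.mem_range.2 (by omega))]
    _ ≤ 16 := by linarith

theorem sum_centralDiffCoeff_div_sq_mul_sub :
    ∑ j ∈ Finset.range (2 * N + 1), centralDiffCoeff N j / ((j : ℝ) - N) ^ 2 * ((j : ℝ) - N) =
      0 := by
  refine eq_zero_of_neg_eq ?_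
  rw [← Finset.sum_neg_distrib, ← Finset.sum_flip]
  refine Finset.sum_congr rfl fun j hj => ?_
  have hj := Finset.mem_range_succ_iff.1 hj
  rw [centralDiffCoeff_sub N hj, Nat.cast_sub hj]
  push_cast
  ring

theorem sum_centralDiffCoeff_div_sq_mul_sq (hN : 1 ≤ N) :
    ∑ j ∈ Finset.range (2 * N + 1), centralDiffCoeff N j / ((j : ℝ) - N) ^ 2 * ((j : ℝ) - N) ^ 2 =
      -1 := by
  have hterm (j : ℕ) : centralDiffCoeff N j / ((j : ℝ) - N) ^ 2 * ((j : ℝ) - N) ^ 2 =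
      centralDiffCoeff N j * ((j : ℝ) - N) ^ 0 - if j = N then 1 else 0 := by
    split_ifs with h
    · simp [h, centralDiffCoeff_self]
    · have : (j : ℝ) - N ≠ 0 := sub_ne_zero.2 (by exact_mod_cast h)
      field_simp
      simp
  simp only [hterm]
  rw [Finset.sum_sub_distrib, sum_centralDiffCoeff_mul_pow N (by omega), Finset.sum_ite_eq',
    if_pos (Finset.mem_range.2 (by omega)), zero_sub]

theorem sum_centralDiffCoeff_div_sq_mul_pow_add_three {s : ℕ} (hs : s + 1 < 2 * N) :
    ∑ j ∈ Finset.range (2 * N + 1),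
      centralDiffCoeff N j / ((j : ℝ) - N) ^ 2 * ((j : ℝ) - N) ^ (s + 3) = 0 := by
  rw [← sum_centralDiffCoeff_mul_pow N hs]
  refine Finset.sum_congr rfl fun j _ => ?_
  rcases eq_or_ne ((j : ℝ) - N) 0 with h | h
  · simp [h]
  · field_simp
    ring

theorem isDifferentiationRule_secondDerivWeight (hN : 1 ≤ N) :
    IsDifferentiationRule (Finset.range (2 * N + 1)) (secondDerivWeight N)
      (fun j => (j : ℝ) - N) 2 (2 * N + 1) := by
  intro s hs
  have hsplit : ∑ j ∈ Finset.range (2 * N + 1), secondDerivWeight N j * ((j : ℝ) - N) ^ s =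
      -2 * ∑ j ∈ Finset.range (2 * N + 1),
        centralDiffCoeff N j / ((j : ℝ) - N) ^ 2 * ((j : ℝ) - N) ^ s +
      2 * (∑ j ∈ Finset.range (2 * N + 1), centralDiffCoeff N j / ((j : ℝ) - N) ^ 2) * 0 ^ s := by
    simp only [secondDerivWeight, add_mul, ite_mul, zero_mul, mul_assoc]
    rw [Finset.sum_add_distrib, Finset.sum_ite_eq', if_pos (Finset.mem_range.2 (by omega)),
      sub_self, ← Finset.mul_sum]
  rw [hsplit]
  match s with
  | 0 => simp
  | 1 => simp [sum_centralDiffCoeff_div_sq_mul_sub]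
  | 2 => simp [sum_centralDiffCoeff_div_sq_mul_sq N hN]
  | s + 3 => simp [sum_centralDiffCoeff_div_sq_mul_pow_add_three N (s := s) (by omega)]

end SecondDerivative

section LagrangeRule

open Polynomial

theorem abs_coeff_prod_X_sub_C_mul_pow_le {ι : Type*} (A : Finset ι) (r : ι → ℝ) {R : ℝ}
    (hR : 0 ≤ R) (i : ℕ) :
    |(∏ a ∈ A, (X - C (r a))).coeff i| * R ^ i ≤ ∏ a ∈ A, (R + |r a|) := by
  induction A using Finset.cons_induction generalizing i with
  | empty =>
    rw [Finset.prod_empty, Finset.prod_empty, coeff_one]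
    split_ifs with h <;> simp [h]
  | cons a A ha ih =>
    rw [Finset.prod_cons, Finset.prod_cons, sub_mul, coeff_sub, coeff_C_mul]
    set Q := ∏ a ∈ A, (X - C (r a))
    have hX : |(X * Q).coeff i| * R ^ i ≤ R * ∏ a ∈ A, (R + |r a|) := by
      cases i with
      | zero =>
        rw [mul_coeff_zero, coeff_X_zero, zero_mul, abs_zero, zero_mul]
        exact mul_nonneg hR (Finset.prod_nonneg fun a _ => by positivity)
      | succ i =>
        rw [coeff_X_mul, pow_succ, ← mul_assoc, mul_comm]
        gcongr
        exact ih i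
    calc |(X * Q).coeff i - r a * Q.coeff i| * R ^ i
        ≤ (|(X * Q).coeff i| + |r a * Q.coeff i|) * R ^ i := by gcongr; exact abs_sub _ _
      _ = |(X * Q).coeff i| * R ^ i + |r a| * (|Q.coeff i| * R ^ i) := by rw [abs_mul]; ring
      _ ≤ R * ∏ a ∈ A, (R + |r a|) + |r a| * ∏ a ∈ A, (R + |r a|) := by
        gcongr
        exact ih i
      _ = (R + |r a|) * ∏ a ∈ A, (R + |r a|) := (add_mul _ _ _).symm

theorem abs_prod_range_erase_sub (j b : ℕ) :
    |∏ r ∈ (Finset.range (j + b + 1)).erase j, ((j : ℝ) - r)| = j.factorial * b.factorial := by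
  have hleft : ∏ r ∈ Finset.range j, |(j : ℝ) - r| = j.factorial := by
    rw [← j.descFactorial_self, Nat.descFactorial_eq_prod_range, Nat.cast_prod]
    refine Finset.prod_congr rfl fun r hr => ?_
    rw [← Nat.cast_sub (Finset.mem_range.1 hr).le, Nat.abs_cast]
  have hright : ∏ r ∈ Finset.range b, |(j : ℝ) - (j + 1 + r : ℕ)| = b.factorial := by
    rw [← Finset.prod_range_add_one_eq_factorial, Nat.cast_prod]
    refine Finset.prod_congr rfl fun r _ => ?_
    rw [add_assoc, add_comm 1, Nat.cast_add, sub_add_cancel_left, abs_neg, Nat.abs_cast]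
  have hsplit : (Finset.range (j + b + 1)).erase j =
      Finset.range j ∪ Finset.Ico (j + 1) (j + 1 + b) := by grind
  rw [hsplit, Finset.abs_prod, Finset.prod_union (Finset.disjoint_left.2 (by grind)), hleft,
    Finset.prod_Ico_eq_prod_range, Nat.add_sub_cancel_left, hright]

theorem pow_self_div_factorial_le (m : ℕ) : (m : ℝ) ^ m / (m.factorial : ℝ) ≤ 3 ^ m := by
  refine (Real.pow_div_factorial_le_exp _ (Nat.cast_nonneg m) m).trans ?_
  rw [← mul_one (m : ℝ), Real.exp_nat_mul]
  gcongr
  exact Real.exp_one_lt_three.le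

/-- The weights, at the nodes `0, …, m`, of the rule which differentiates `i` times at `0` the
Lagrange interpolation polynomial. -/
def lagrangeWeight (m i j : ℕ) : ℝ :=
  i.factorial * ((∏ r ∈ (Finset.range (m + 1)).erase j, (X - C (r : ℝ))).coeff i /
    ∏ r ∈ (Finset.range (m + 1)).erase j, ((j : ℝ) - r))

variable {m i : ℕ}

theorem isDifferentiationRule_lagrangeWeight (m i : ℕ) :
    IsDifferentiationRule (Finset.range (m + 1)) (lagrangeWeight m i) (fun j => (j : ℝ)) i m := by
  intro s hs
  have h := Lagrange.eq_interpolate (s := Finset.range (m + 1)) (v := fun j : ℕ => (j : ℝ))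
    (f := (X : ℝ[X]) ^ s) Nat.cast_injective.injOn
    (by rw [degree_X_pow, Finset.card_range]; exact_mod_cast Nat.lt_succ_of_le hs)
  rw [Lagrange.interpolate_eq_sum] at h
  have hcoeff := congrArg (fun P : ℝ[X] => P.coeff i) h
  simp only [coeff_X_pow, finsetSum_coeff, coeff_C_mul, eval_pow, eval_X] at hcoeff
  calc ∑ j ∈ Finset.range (m + 1), lagrangeWeight m i j * (j : ℝ) ^ s
      = i.factorial * if i = s then 1 else 0 := by
        rw [hcoeff, Finset.mul_sum]
        refine Finset.sum_congr rfl fun j _ => ?_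
        rw [lagrangeWeight]
        ring
    _ = if s = i then (i.factorial : ℝ) else 0 := by simp [eq_comm]

theorem factorial_mul_abs_coeff_prod_range_erase_le (hi : i ≤ m) {j : ℕ} (hj : j ≤ m) :
    i.factorial * |(∏ r ∈ (Finset.range (m + 1)).erase j, (X - C (r : ℝ))).coeff i| ≤
      (2 * m : ℝ) ^ m := by
  calc i.factorial * |(∏ r ∈ (Finset.range (m + 1)).erase j, (X - C (r : ℝ))).coeff i|
      ≤ (m : ℝ) ^ i * |(∏ r ∈ (Finset.range (m + 1)).erase j, (X - C (r : ℝ))).coeff i| := by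
        gcongr
        exact_mod_cast i.factorial_le_pow.trans (Nat.pow_le_pow_left hi i)
    _ ≤ ∏ r ∈ (Finset.range (m + 1)).erase j, ((m : ℝ) + |(r : ℝ)|) := by
        rw [mul_comm]
        exact abs_coeff_prod_X_sub_C_mul_pow_le _ _ (Nat.cast_nonneg m) i
    _ ≤ ∏ _r ∈ (Finset.range (m + 1)).erase j, (2 * m : ℝ) := by
        refine Finset.prod_le_prod (fun _ _ => by positivity) fun r hr => ?_
        have : (r : ℝ) ≤ m := by
          exact_mod_cast Finset.mem_range_succ_iff.1 (Finset.mem_of_mem_erase hr)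
        rw [Nat.abs_cast]
        linarith
    _ = (2 * m : ℝ) ^ m := by
        rw [Finset.prod_const, Finset.card_erase_of_mem (Finset.mem_range_succ_iff.2 hj),
          Finset.card_range, Nat.succ_sub_one]

theorem abs_lagrangeWeight_le (hi : i ≤ m) {j : ℕ} (hj : j ≤ m) :
    |lagrangeWeight m i j| ≤ (2 * m : ℝ) ^ m / m.factorial * m.choose j := by
  have h := factorial_mul_abs_coeff_prod_range_erase_le hi hj
  obtain ⟨b, rfl⟩ := Nat.exists_eq_add_of_le hj
  rw [lagrangeWeight, abs_mul, abs_div, Nat.abs_cast, ← mul_div_assoc, abs_prod_range_erase_sub,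
    Nat.cast_add_choose, div_mul_div_cancel₀ (by positivity)]
  gcongr

theorem sum_abs_lagrangeWeight_le (hi : i ≤ m) :
    ∑ j ∈ Finset.range (m + 1), |lagrangeWeight m i j| ≤ 12 ^ m := by
  calc ∑ j ∈ Finset.range (m + 1), |lagrangeWeight m i j|
      ≤ ∑ j ∈ Finset.range (m + 1), (2 * m : ℝ) ^ m / m.factorial * m.choose j :=
        Finset.sum_le_sum fun j hj => abs_lagrangeWeight_le hi (Finset.mem_range_succ_iff.1 hj)
    _ = 4 ^ m * ((m : ℝ) ^ m / m.factorial) := by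
        rw [← Finset.mul_sum, ← Nat.cast_sum, Nat.sum_range_choose, mul_pow,
          show (4 : ℝ) = 2 * 2 by norm_num, mul_pow]
        push_cast
        ring
    _ ≤ 4 ^ m * 3 ^ m := by
        gcongr
        exact pow_self_div_factorial_le m
    _ = 12 ^ m := by rw [← mul_pow]; norm_num

end LagrangeRule

section LandauKolmogorov

variable {E : Type*} [NormedAddCommGroup E] [NormedSpace ℝ E] [MeasurableSpace E] [BorelSpace E]
  [SecondCountableTopology E] {μ : Measure E} [SFinite μ] [μ.IsAddRightInvariant]
  {G : Type*} [NormedAddCommGroup G] [NormedSpace ℝ G] [CompleteSpace G]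
  {v : E} {F : ℕ → E → G} {Ω Ω' : Set E} {p q : ℝ≥0∞} {T : ℝ}

theorem IsDifferentiationRule.eLpNorm_lineDeriv_le_mul {ι : Type*} {J : Finset ι} {w t : ι → ℝ}
    {i m : ℕ} {τ W ε : ℝ} (hw : IsDifferentiationRule J w t i m) (hi : i ≤ m)
    (ht : ∀ j ∈ J, |t j| ≤ τ) (hW : ∑ j ∈ J, |w j| ≤ W) (hτ : 0 ≤ τ) (hε : 0 < ε) (hT : 0 < T)
    (hp : 1 ≤ p) (hΩ : MeasurableSet Ω) (hΩ' : MeasurableSet Ω') (hF : IsLineDerivSeqOn v F Ω')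
    (hsub : ∀ x ∈ Ω, ∀ u : ℝ, |u| ≤ ε * τ / T → x + u • v ∈ Ω')
    (h0 : eLpNorm (F 0) p (μ.restrict Ω') ≤ q)
    (hm : eLpNorm (F (m + 1)) p (μ.restrict Ω') ≤ ENNReal.ofReal (T ^ (m + 1)) * q) :
    eLpNorm (F i) p (μ.restrict Ω) ≤
      ENNReal.ofReal (W * (T / ε) ^ i * (1 + 2 * (ε * τ) ^ (m + 1) / m.factorial)) * q := by
  have hW0 : 0 ≤ W := (Finset.sum_nonneg fun _ _ => abs_nonneg _).trans hW
  have hsub' : ∀ x ∈ Ω, ∀ u : ℝ, |u| ≤ ε / T * τ → x + u • v ∈ Ω' := fun x hx u hu =>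
    hsub x hx u (hu.trans_eq (by ring))
  calc eLpNorm (F i) p (μ.restrict Ω)
      ≤ ENNReal.ofReal (W / (ε / T) ^ i) * (eLpNorm (F 0) p (μ.restrict Ω') +
          ENNReal.ofReal (2 * (ε / T * τ) ^ (m + 1) / m.factorial) *
            eLpNorm (F (m + 1)) p (μ.restrict Ω')) :=
        hw.eLpNorm_lineDeriv_le hi ht hW hτ (by positivity) hp hΩ hΩ' hF hsub'
    _ ≤ ENNReal.ofReal (W / (ε / T) ^ i) * (q +
          ENNReal.ofReal (2 * (ε / T * τ) ^ (m + 1) / m.factorial) *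
            (ENNReal.ofReal (T ^ (m + 1)) * q)) := by gcongr
    _ = ENNReal.ofReal (W / (ε / T) ^ i *
          (1 + 2 * (ε / T * τ) ^ (m + 1) / m.factorial * T ^ (m + 1))) * q := by
        rw [ENNReal.ofReal_mul (by positivity), ENNReal.ofReal_add zero_le_one (by positivity),
          ENNReal.ofReal_mul (by positivity), ENNReal.ofReal_one, mul_assoc, add_mul, one_mul,
          mul_assoc]
    _ = _ := by
        have hscale : (ε / T * τ) ^ (m + 1) * T ^ (m + 1) = (ε * τ) ^ (m + 1) := by
          rw [← mul_pow, mul_right_comm, div_mul_cancel₀ _ hT.ne']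
        rw [← hscale, ← inv_div ε T, inv_pow]
        congr 2
        ring

theorem pow_succ_self_div_factorial_le (m : ℕ) :
    (m : ℝ) ^ (m + 1) / (m.factorial : ℝ) ≤ 6 ^ m := by
  have hm : (m : ℝ) ≤ 2 ^ m := by exact_mod_cast m.lt_two_pow_self.le
  calc (m : ℝ) ^ (m + 1) / (m.factorial : ℝ) = m * ((m : ℝ) ^ m / m.factorial) := by ring
    _ ≤ 2 ^ m * 3 ^ m := by
      gcongr
      exact pow_self_div_factorial_le m
    _ = 6 ^ m := by rw [← mul_pow]; norm_num

theorem two_mul_sixth_mul_pow_succ_self_div_factorial_le (m : ℕ) :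
    2 * (1 / 6 * (m : ℝ)) ^ (m + 1) / m.factorial ≤ 1 / 3 := by
  calc 2 * (1 / 6 * (m : ℝ)) ^ (m + 1) / m.factorial
      = 2 * (1 / 6) ^ (m + 1) * ((m : ℝ) ^ (m + 1) / m.factorial) := by rw [mul_pow]; ring
    _ ≤ 2 * (1 / 6) ^ (m + 1) * 6 ^ m := by gcongr; exact pow_succ_self_div_factorial_le m
    _ = 1 / 3 := by rw [pow_succ, div_pow]; field_simp; norm_num

theorem IsLineDerivSeqOn.eLpNorm_two_le (hF : IsLineDerivSeqOn v F univ) (hp : 1 ≤ p) {N : ℕ}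
    (hN : 2 ≤ N) (hT : 0 < T) (h0 : eLpNorm (F 0) p μ ≤ q)
    (hFN : eLpNorm (F N) p μ ≤ ENNReal.ofReal (T ^ N) * q) :
    eLpNorm (F 2) p μ ≤ ENNReal.ofReal ((28 * T) ^ 2) * q := by
  rcases hN.eq_or_lt with rfl | hN
  · refine hFN.trans ?_
    gcongr
    linarith
  obtain ⟨m, rfl⟩ : ∃ m, N = m + 1 := ⟨N - 1, by omega⟩
  have hnodes (j : ℕ) (hj : j ∈ Finset.range (2 * (m / 2) + 1)) :
      |(j : ℝ) - (m / 2 : ℕ)| ≤ m := by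
    have hj : j ≤ 2 * (m / 2) := Finset.mem_range_succ_iff.1 hj
    rw [abs_le]
    constructor
    · linarith [show (m / 2 : ℕ) ≤ (m : ℝ) by exact_mod_cast Nat.div_le_self m 2,
        (Nat.cast_nonneg j : (0 : ℝ) ≤ j)]
    · linarith [show (j : ℝ) ≤ m by exact_mod_cast hj.trans (Nat.mul_div_le m 2),
        (Nat.cast_nonneg (m / 2) : (0 : ℝ) ≤ (m / 2 : ℕ))]
  rw [← μ.restrict_univ] at h0 hFN ⊢
  refine (((isDifferentiationRule_secondDerivWeight (m / 2) (by omega)).mono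
    (by omega)).eLpNorm_lineDeriv_le_mul (ε := 1 / 6) (by omega) hnodes
    (sum_abs_secondDerivWeight_le _) m.cast_nonneg (by norm_num) hT hp .univ .univ hF
    (fun _ _ _ _ => mem_univ _) h0 hFN).trans ?_
  gcongr
  calc 16 * (T / (1 / 6)) ^ 2 * (1 + 2 * (1 / 6 * (m : ℝ)) ^ (m + 1) / m.factorial)
      ≤ 16 * (T / (1 / 6)) ^ 2 * (1 + 1 / 3) := by
        gcongr 16 * (T / (1 / 6)) ^ 2 * (1 + ?_)
        exact two_mul_sixth_mul_pow_succ_self_div_factorial_le m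
    _ ≤ (28 * T) ^ 2 := by nlinarith [sq_nonneg T]

theorem isDifferentiationRule_two_point :
    IsDifferentiationRule (Finset.range 2) (fun j => 2 * (j : ℝ) - 1) (fun j => (j : ℝ)) 1 1 := by
  intro s hs
  interval_cases s <;> norm_num [Finset.sum_range_succ]

theorem IsLineDerivSeqOn.eLpNorm_one_le (hF : IsLineDerivSeqOn v F univ) (hp : 1 ≤ p) {N : ℕ}
    (hN : 1 ≤ N) (hT : 0 < T) (h0 : eLpNorm (F 0) p μ ≤ q)
    (hFN : eLpNorm (F N) p μ ≤ ENNReal.ofReal (T ^ N) * q) :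
    eLpNorm (F 1) p μ ≤ ENNReal.ofReal (168 * T) * q := by
  rcases hN.eq_or_lt with rfl | hN
  · refine hFN.trans ?_
    gcongr
    rw [pow_one]
    linarith
  have hF2 := hF.eLpNorm_two_le hp hN hT h0 hFN
  rw [← μ.restrict_univ] at h0 hF2 ⊢
  refine (isDifferentiationRule_two_point.eLpNorm_lineDeriv_le_mul (τ := 1) (W := 2) (ε := 1)
    le_rfl (fun j hj => ?_) (by norm_num [Finset.sum_range_succ]) zero_le_one one_pos
    (by positivity) hp .univ .univ hF (fun _ _ _ _ => mem_univ _) h0 hF2).trans_eq ?_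
  · rw [Nat.abs_cast]
    exact_mod_cast Finset.mem_range_succ_iff.1 hj
  · congr 2
    norm_num
    ring

theorem IsLineDerivSeqOn.eLpNorm_le (hF : IsLineDerivSeqOn v F Ω') (hp : 1 ≤ p)
    (hΩ : MeasurableSet Ω) (hΩ' : MeasurableSet Ω') {N i : ℕ} (hi : i ≤ N) (hT : 0 < T)
    (hsub : ∀ x ∈ Ω, ∀ u : ℝ, |u| ≤ N / T → x + u • v ∈ Ω')
    (h0 : eLpNorm (F 0) p (μ.restrict Ω') ≤ q)
    (hFN : eLpNorm (F N) p (μ.restrict Ω') ≤ ENNReal.ofReal (T ^ N) * q) :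
    eLpNorm (F i) p (μ.restrict Ω) ≤ ENNReal.ofReal (72 ^ N * T ^ i) * q := by
  rcases hi.eq_or_lt with rfl | hi
  · have hΩΩ' : Ω ⊆ Ω' := fun x hx => by
      simpa using hsub x hx 0 (by rw [abs_zero]; positivity)
    refine ((eLpNorm_mono_measure _ (Measure.restrict_mono hΩΩ' le_rfl)).trans hFN).trans ?_
    gcongr
    exact le_mul_of_one_le_left (by positivity) (one_le_pow₀ (by norm_num))
  obtain ⟨m, rfl⟩ : ∃ m, N = m + 1 := ⟨N - 1, by omega⟩
  have him : i ≤ m := Nat.lt_succ_iff.1 hi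
  have hnodes (j : ℕ) (hj : j ∈ Finset.range (m + 1)) : |(j : ℝ)| ≤ m := by
    rw [Nat.abs_cast]
    exact_mod_cast Finset.mem_range_succ_iff.1 hj
  refine ((isDifferentiationRule_lagrangeWeight m i).eLpNorm_lineDeriv_le_mul (ε := 1) him hnodes
    (sum_abs_lagrangeWeight_le him) m.cast_nonneg one_pos hT hp hΩ hΩ' hF (fun x hx u hu =>
      hsub x hx u (hu.trans (by push_cast; gcongr; linarith))) h0 hFN).trans ?_
  gcongr ENNReal.ofReal ?_ * q
  calc 12 ^ m * (T / 1) ^ i * (1 + 2 * (1 * (m : ℝ)) ^ (m + 1) / m.factorial)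
      = 12 ^ m * T ^ i * (1 + 2 * ((m : ℝ) ^ (m + 1) / m.factorial)) := by
        rw [div_one, one_mul, mul_div_assoc]
    _ ≤ 12 ^ m * T ^ i * (6 ^ m + 2 * 6 ^ m) := by
        gcongr
        · exact one_le_pow₀ (by norm_num)
        · exact pow_succ_self_div_factorial_le m
    _ = 3 * (72 ^ m * T ^ i) := by
        rw [show (72 : ℝ) = 12 * 6 by norm_num, mul_pow]
        ring
    _ ≤ 72 * (72 ^ m * T ^ i) := by gcongr; norm_num
    _ = 72 ^ (m + 1) * T ^ i := by ring

end LandauKolmogorov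

section MultiIndex

variable {n : ℕ}

theorem multiOrder_add (α β : Fin n → ℕ) :
    multiOrder (α + β) = multiOrder α + multiOrder β := Finset.sum_add_distrib

theorem multiOrder_single (i : Fin n) (c : ℕ) : multiOrder (Pi.single i c) = c :=
  Finset.sum_pi_single' i c Finset.univ |>.trans (if_pos (Finset.mem_univ i))

theorem multiOrder_sum_single (γ : Fin n → ℕ) (S : Finset (Fin n)) :
    multiOrder (∑ i ∈ S, Pi.single i (γ i)) = ∑ i ∈ S, γ i := by
  simp_rw [multiOrder, Finset.sum_apply]
  rw [Finset.sum_comm]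
  exact Finset.sum_congr rfl fun i _ => multiOrder_single i (γ i)

theorem exists_eq_add_single {α : Fin n → ℕ} {a : ℕ} (h : multiOrder α = a + 1) :
    ∃ (β : Fin n → ℕ) (i : Fin n), α = β + Pi.single i 1 ∧ multiOrder β = a := by
  obtain ⟨i, -, hi⟩ : ∃ i ∈ Finset.univ, α i ≠ 0 :=
    Finset.exists_ne_zero_of_sum_ne_zero (h.trans_ne a.succ_ne_zero)
  have hα : α = (α - Pi.single i 1) + Pi.single i 1 :=
    (tsub_add_cancel_of_le
      (update_le_iff.2 ⟨Nat.one_le_iff_ne_zero.2 hi, fun _ _ => Nat.zero_le _⟩)).symm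
  refine ⟨_, i, hα, ?_⟩
  rw [hα, multiOrder_add, multiOrder_single] at h
  exact Nat.succ_injective h

theorem exists_eq_add_of_multiOrder_eq_add {α : Fin n → ℕ} {a b : ℕ}
    (h : multiOrder α = a + b) :
    ∃ β γ : Fin n → ℕ, α = β + γ ∧ multiOrder β = a ∧ multiOrder γ = b := by
  induction b generalizing α with
  | zero => exact ⟨α, 0, (add_zero α).symm, h, Finset.sum_const_zero⟩
  | succ b ih =>
    obtain ⟨α', r, rfl, h'⟩ := exists_eq_add_single h
    obtain ⟨β, γ, rfl, hβ, hγ⟩ := ih h'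
    exact ⟨β, γ + Pi.single r 1, add_assoc _ _ _, hβ, by
      rw [multiOrder_add, multiOrder_single, hγ]⟩

end MultiIndex

section DerivNorm

variable {𝕜 : Type*} [RCLike 𝕜] {n : ℕ} {f : EuclideanSpace ℝ (Fin n) → 𝕜} {p q : ℝ≥0∞}
  {U V Ω : Set (EuclideanSpace ℝ (Fin n))} {a i N : ℕ} {T δ : ℝ}

/-- The largest of the norms `‖∂^α f‖_{L^p(Ω)}` over the multi-indices `α` of order `l`. -/
def derivNorm (f : EuclideanSpace ℝ (Fin n) → 𝕜) (p : ℝ≥0∞)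
    (Ω : Set (EuclideanSpace ℝ (Fin n))) (l : ℕ) : ℝ≥0∞ :=
  (Finset.piAntidiag Finset.univ l).sup fun α => eLpNorm (multiDeriv α f) p (volume.restrict Ω)

theorem derivNorm_le_iff {l : ℕ} :
    derivNorm f p Ω l ≤ q ↔
      ∀ α, multiOrder α = l → eLpNorm (multiDeriv α f) p (volume.restrict Ω) ≤ q := by
  simp [derivNorm, multiOrder]

theorem eLpNorm_multiDeriv_le_derivNorm (f : EuclideanSpace ℝ (Fin n) → 𝕜) (p : ℝ≥0∞)
    (Ω : Set (EuclideanSpace ℝ (Fin n))) (α : Fin n → ℕ) :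
    eLpNorm (multiDeriv α f) p (volume.restrict Ω) ≤ derivNorm f p Ω (multiOrder α) :=
  derivNorm_le_iff.1 le_rfl α rfl

theorem derivNorm_mono (h : Ω ⊆ V) (l : ℕ) : derivNorm f p Ω l ≤ derivNorm f p V l :=
  Finset.sup_mono_fun fun _ _ => eLpNorm_mono_measure _ (Measure.restrict_mono h le_rfl)

theorem derivNorm_lt_top (hU : IsOpen U) (hf : ContDiffOn ℝ ∞ f U) (hΩ : IsCompact (closure Ω))
    (hΩU : closure Ω ⊆ U) (p : ℝ≥0∞) (l : ℕ) : derivNorm f p Ω l < ⊤ := by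
  refine (Finset.sup_lt_iff ENNReal.zero_lt_top).2 fun α _ => ?_
  obtain ⟨c, hc⟩ := hΩ.exists_bound_of_continuousOn
    ((contDiffOn_multiDeriv hU hf α).continuousOn.mono hΩU)
  have : IsFiniteMeasure (volume.restrict (closure Ω)) :=
    isFiniteMeasure_restrict.2 hΩ.measure_lt_top.ne
  calc eLpNorm (multiDeriv α f) p (volume.restrict Ω)
      ≤ eLpNorm (multiDeriv α f) p (volume.restrict (closure Ω)) :=
        eLpNorm_mono_measure _ (Measure.restrict_mono subset_closure le_rfl)
    _ ≤ eLpNorm (fun _ => c) p (volume.restrict (closure Ω)) :=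
        eLpNorm_mono_ae_real ((ae_restrict_mem isClosed_closure.measurableSet).mono hc)
    _ < ⊤ := (memLp_const c).eLpNorm_lt_top

theorem isLineDerivSeqOn_multiDeriv (hU : IsOpen U) (hf : ContDiffOn ℝ ∞ f U) (β : Fin n → ℕ)
    (r : Fin n) :
    IsLineDerivSeqOn (EuclideanSpace.single r (1 : ℝ))
      (fun s => multiDeriv (β + Pi.single r s) f) U where
  continuousOn s := (contDiffOn_multiDeriv hU hf _).continuousOn
  hasLineDerivAt s x hx := by
    rw [Pi.single_add, ← add_assoc]
    exact hasLineDerivAt_multiDeriv hU hf (β + Pi.single r s) r hx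

theorem ofReal_pow_mul_le {c : ℝ} (hc : 1 ≤ c) (hT : 0 ≤ T) (hi : i ≤ N) (q : ℝ≥0∞) :
    ENNReal.ofReal (T ^ N) * q ≤
      ENNReal.ofReal (T ^ (N - i)) * (ENNReal.ofReal (c * T ^ i) * q) := by
  rw [← mul_assoc, ← ENNReal.ofReal_mul (by positivity)]
  gcongr
  calc T ^ N = T ^ (N - i) * (1 * T ^ i) := by rw [one_mul, pow_sub_mul_pow T hi]
    _ ≤ T ^ (N - i) * (c * T ^ i) := by gcongr

theorem derivNorm_succ_le (hf : ContDiff ℝ ∞ f) (hp : 1 ≤ p) (hN : 1 ≤ N) (hT : 0 < T)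
    (ha : derivNorm f p univ a ≤ q)
    (haN : derivNorm f p univ (a + N) ≤ ENNReal.ofReal (T ^ N) * q) :
    derivNorm f p univ (a + 1) ≤ ENNReal.ofReal (168 * T) * q := by
  refine derivNorm_le_iff.2 fun α hα => ?_
  obtain ⟨β, r, rfl, hβ⟩ := exists_eq_add_single hα
  have hbound (s : ℕ) : eLpNorm (multiDeriv (β + Pi.single r s) f) p volume ≤
      derivNorm f p univ (a + s) := by
    have h := eLpNorm_multiDeriv_le_derivNorm f p univ (β + Pi.single r s)
    rwa [multiOrder_add, multiOrder_single, hβ, Measure.restrict_univ] at h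
  rw [Measure.restrict_univ]
  exact (isLineDerivSeqOn_multiDeriv isOpen_univ hf.contDiffOn β r).eLpNorm_one_le hp hN hT
    ((hbound 0).trans ha) ((hbound N).trans haN)

theorem derivNorm_add_le (hf : ContDiff ℝ ∞ f) (hp : 1 ≤ p) (hT : 0 < T) (hi : i ≤ N)
    (ha : derivNorm f p univ a ≤ q)
    (haN : derivNorm f p univ (a + N) ≤ ENNReal.ofReal (T ^ N) * q) :
    derivNorm f p univ (a + i) ≤ ENNReal.ofReal ((168 * T) ^ i) * q := by
  induction i with
  | zero => simpa using ha
  | succ i ih =>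
    have hrest : derivNorm f p univ (a + i + (N - i)) ≤
        ENNReal.ofReal (T ^ (N - i)) * (ENNReal.ofReal ((168 * T) ^ i) * q) := by
      rw [add_assoc, Nat.add_sub_of_le (by omega), mul_pow]
      exact haN.trans (ofReal_pow_mul_le (one_le_pow₀ (by norm_num)) hT.le (by omega) q)
    calc derivNorm f p univ (a + i + 1)
        ≤ ENNReal.ofReal (168 * T) * (ENNReal.ofReal ((168 * T) ^ i) * q) :=
          derivNorm_succ_le hf hp (by omega) hT (ih (by omega)) hrest
      _ = ENNReal.ofReal ((168 * T) ^ (i + 1)) * q := by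
          rw [← mul_assoc, ← ENNReal.ofReal_mul (by positivity), pow_succ']

theorem eLpNorm_multiDeriv_add_single_le (hU : IsOpen U) (hf : ContDiffOn ℝ ∞ f U) (hp : 1 ≤ p)
    (hΩ : IsOpen Ω) (hΩU : Metric.thickening δ Ω ⊆ U) (hT : 0 < T) (hδ : N / T < δ) (hi : i ≤ N)
    {β : Fin n → ℕ} {r : Fin n}
    (h0 : eLpNorm (multiDeriv β f) p (volume.restrict (Metric.thickening δ Ω)) ≤ q)
    (hN : eLpNorm (multiDeriv (β + Pi.single r N) f) p
      (volume.restrict (Metric.thickening δ Ω)) ≤ ENNReal.ofReal (T ^ N) * q) :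
    eLpNorm (multiDeriv (β + Pi.single r i) f) p (volume.restrict Ω) ≤
      ENNReal.ofReal (72 ^ N * T ^ i) * q := by
  refine ((isLineDerivSeqOn_multiDeriv hU hf β r).mono hΩU).eLpNorm_le hp hΩ.measurableSet
    Metric.isOpen_thickening.measurableSet hi hT (fun x hx u hu => ?_) ?_ hN
  · refine Metric.mem_thickening_iff.2 ⟨x, hx, ?_⟩
    rw [dist_self_add_left, norm_smul, PiLp.norm_single, norm_one, mul_one, Real.norm_eq_abs]
    exact hu.trans_lt hδ
  · simpa only [Pi.single_zero, add_zero] using h0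

theorem eLpNorm_multiDeriv_le_of_multiOrder_eq {c : ℝ} (hc : 1 ≤ c) (hT : 0 ≤ T) (hi : i ≤ N)
    (hΩV : Ω ⊆ V) {α : Fin n → ℕ} (hα : multiOrder α = a + N)
    (haN : derivNorm f p V (a + N) ≤ ENNReal.ofReal (T ^ N) * q) :
    eLpNorm (multiDeriv α f) p (volume.restrict Ω) ≤
      ENNReal.ofReal (T ^ (N - i)) * (ENNReal.ofReal (c * T ^ i) * q) :=
  ((derivNorm_le_iff.1 (derivNorm_mono hΩV _) α hα).trans haN).trans (ofReal_pow_mul_le hc hT hi q)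

theorem eLpNorm_multiDeriv_add_sum_single_le (hU : IsOpen U) (hf : ContDiffOn ℝ ∞ f U)
    (hVU : V ⊆ U) (hp : 1 ≤ p) (hT : 0 < T) (hδ : N / T < δ) (ha : derivNorm f p V a ≤ q)
    (haN : derivNorm f p V (a + N) ≤ ENNReal.ofReal (T ^ N) * q) (S : Finset (Fin n))
    (hΩ : IsOpen Ω) (hΩV : Metric.thickening ((S.card + 1) * δ) Ω ⊆ V)
    {β γ : Fin n → ℕ} (hβ : multiOrder β = a) (hγ : ∑ i ∈ S, γ i ≤ N) :
    eLpNorm (multiDeriv (β + ∑ i ∈ S, Pi.single i (γ i)) f) p (volume.restrict Ω) ≤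
      ENNReal.ofReal (72 ^ (N * S.card) * T ^ ∑ i ∈ S, γ i) * q := by
  have hδ0 : 0 < δ := lt_of_le_of_lt (by positivity) hδ
  have hΩ_sub : Ω ⊆ V := (Metric.self_subset_thickening (by positivity) _).trans hΩV
  induction S using Finset.induction_on generalizing Ω with
  | empty =>
    have h := (eLpNorm_multiDeriv_le_derivNorm f p Ω β).trans (derivNorm_mono hΩ_sub _)
    simpa using h.trans (hβ ▸ ha)
  | insert r S hr ih =>
    rw [Finset.sum_insert hr] at hγ
    rw [Finset.card_insert_of_notMem hr] at hΩV ⊢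
    set s := ∑ i ∈ S, γ i
    set β' := β + ∑ i ∈ S, Pi.single i (γ i)
    have hthick : Metric.thickening ((S.card + 1) * δ) (Metric.thickening δ Ω) ⊆ V := by
      refine (Metric.thickening_thickening_subset _ _ _).trans (Eq.trans_subset ?_ hΩV)
      congr 1
      push_cast
      ring
    have hδV : Metric.thickening δ Ω ⊆ V :=
      (Metric.self_subset_thickening (by positivity) _).trans hthick
    have horder : multiOrder (β' + Pi.single r (N - s)) = a + N := by
      rw [multiOrder_add, multiOrder_add, multiOrder_sum_single, multiOrder_single, hβ]
      omega
    have htop := eLpNorm_multiDeriv_le_of_multiOrder_eq (one_le_pow₀ (n := N * S.card)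
      (by norm_num : (1 : ℝ) ≤ 72)) hT.le (by omega : s ≤ N) hδV horder haN
    have hδ' : (N - s : ℕ) / T < δ := lt_of_le_of_lt (by gcongr; exact Nat.sub_le N s) hδ
    rw [Finset.sum_insert hr, Finset.sum_insert hr,
      add_comm (Pi.single r (γ r) : Fin n → ℕ), ← add_assoc]
    refine (eLpNorm_multiDeriv_add_single_le hU hf hp hΩ (hδV.trans hVU) hT hδ' (by omega)
      (ih Metric.isOpen_thickening hthick (by omega) hδV) htop).trans ?_
    rw [← mul_assoc, ← ENNReal.ofReal_mul (by positivity)]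
    gcongr ENNReal.ofReal ?_ * q
    calc (72 : ℝ) ^ (N - s) * T ^ γ r * (72 ^ (N * S.card) * T ^ s)
        ≤ 72 ^ N * T ^ γ r * (72 ^ (N * S.card) * T ^ s) := by
          gcongr
          · norm_num
          · exact Nat.sub_le _ _
      _ = 72 ^ (N * (S.card + 1)) * T ^ (γ r + s) := by ring

theorem derivNorm_add_le_of_thickening (hU : IsOpen U) (hf : ContDiffOn ℝ ∞ f U) (hVU : V ⊆ U)
    (hp : 1 ≤ p) (hT : 0 < T) (hδ : N / T < δ) (hi : i ≤ N) (hΩ : IsOpen Ω)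
    (hΩV : Metric.thickening ((n + 1) * δ) Ω ⊆ V) (ha : derivNorm f p V a ≤ q)
    (haN : derivNorm f p V (a + N) ≤ ENNReal.ofReal (T ^ N) * q) :
    derivNorm f p Ω (a + i) ≤ ENNReal.ofReal (72 ^ (N * n) * T ^ i) * q := by
  refine derivNorm_le_iff.2 fun α hα => ?_
  obtain ⟨β, γ, rfl, hβ, rfl⟩ := exists_eq_add_of_multiOrder_eq_add hα
  simpa only [multiOrder, Finset.univ_sum_single, Finset.card_univ, Fintype.card_fin] using
    eLpNorm_multiDeriv_add_sum_single_le hU hf hVU hp hT hδ ha haN Finset.univ hΩ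
      (by simpa only [Finset.card_univ, Fintype.card_fin] using hΩV) hβ hi

end DerivNorm

section WeightSequences

variable {M : ℕ → ℝ} {k : ℕ → ℕ}

theorem rootSeq_pos (hM : ∀ j, 0 < M j) (j : ℕ) : 0 < rootSeq M j :=
  Real.rpow_pos_of_pos (hM j) _

theorem rootSeq_pow_self {j : ℕ} (hM : 0 ≤ M j) (hj : j ≠ 0) : rootSeq M j ^ j = M j := by
  rw [rootSeq, one_div, Real.rpow_inv_natCast_pow hM hj]

theorem IsWeightSeq.le_quot_pow (hM : IsWeightSeq M) (j : ℕ) : M j ≤ (M (j + 1) / M j) ^ j := by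
  induction j with
  | zero => rw [hM.zero, pow_zero]
  | succ j ih =>
    have hj := hM.pos j
    have hj' := hM.pos (j + 1)
    calc M (j + 1) = M j * (M (j + 1) / M j) := by rw [mul_div_cancel₀ _ hj.ne']
      _ ≤ (M (j + 1) / M j) ^ j * (M (j + 1) / M j) := by gcongr
      _ = (M (j + 1) / M j) ^ (j + 1) := (pow_succ _ _).symm
      _ ≤ (M (j + 1 + 1) / M (j + 1)) ^ (j + 1) :=
        pow_le_pow_left₀ (by positivity) (hM.quot_mono j) _

theorem IsWeightSeq.pow_succ_le_pow (hM : IsWeightSeq M) (j : ℕ) :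
    M j ^ (j + 1) ≤ M (j + 1) ^ j := by
  have hj := hM.pos j
  calc M j ^ (j + 1) = M j ^ j * M j := pow_succ _ _
    _ ≤ M j ^ j * (M (j + 1) / M j) ^ j := by gcongr; exact hM.le_quot_pow j
    _ = M (j + 1) ^ j := by rw [← mul_pow, mul_div_cancel₀ _ hj.ne']

theorem IsWeightSeq.rootSeq_mono (hM : IsWeightSeq M) : Monotone (rootSeq M) := by
  refine monotone_nat_of_le_succ fun j => ?_
  rcases eq_or_ne j 0 with rfl | hj
  · simpa [rootSeq] using hM.one_le
  refine le_of_pow_le_pow_left₀ (mul_ne_zero hj j.succ_ne_zero) (rootSeq_pos hM.pos _).le ?_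
  calc rootSeq M j ^ (j * (j + 1)) = M j ^ (j + 1) := by
        rw [pow_mul, rootSeq_pow_self (hM.pos j).le hj]
    _ ≤ M (j + 1) ^ j := hM.pow_succ_le_pow j
    _ = rootSeq M (j + 1) ^ (j * (j + 1)) := by
        rw [mul_comm, pow_mul, rootSeq_pow_self (hM.pos _).le j.succ_ne_zero]

theorem exists_rootSeq_succ_le (hM : ∀ j, 0 < M j)
    (hkM : BddAbove (range fun j : ℕ => rootSeq M (k (j + 1)) / rootSeq M (k j))) :
    ∃ A : ℝ, 1 ≤ A ∧ ∀ j, rootSeq M (k (j + 1)) ≤ A * rootSeq M (k j) := by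
  obtain ⟨A, hA⟩ := hkM
  refine ⟨max 1 A, le_max_left _ _, fun j => (div_le_iff₀ (rootSeq_pos hM _)).1 ?_⟩
  exact (hA (mem_range_self j)).trans (le_max_right _ _)

theorem IsBaseSeq.exists_le_lt (hk : IsBaseSeq k) (l : ℕ) : ∃ j, k j ≤ l ∧ l < k (j + 1) := by
  obtain ⟨j, hj, hj'⟩ := hk.strictMono.exists_between_of_tendsto_atTop
    hk.strictMono.tendsto_atTop (x := l + 1) (by rw [hk.zero]; exact l.succ_pos)
  exact ⟨j, Nat.lt_succ_iff.1 hj, hj'⟩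

theorem IsSpecialBaseSeq.exists_succ_le (hk : IsSpecialBaseSeq k) :
    ∃ D : ℕ, ∀ j, 1 ≤ j → k (j + 1) ≤ D * k j := by
  obtain ⟨A, hA⟩ := hk.bdd
  refine ⟨⌈A⌉₊, fun j hj => ?_⟩
  have hkj : (0 : ℝ) < k j := by exact_mod_cast hk.zero ▸ hk.strictMono hj
  have h : (k (j + 1) : ℝ) ≤ ⌈A⌉₊ * k j :=
    (div_le_iff₀ hkj).1 ((hA j hj).trans (Nat.le_ceil A))
  exact_mod_cast h

end WeightSequences

section Estimates

variable {𝕜 : Type*} [RCLike 𝕜] {n : ℕ} {p : ℝ≥0∞} {M : ℕ → ℝ} {k : ℕ → ℕ} {S : Set ℕ}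
  {f : EuclideanSpace ℝ (Fin n) → 𝕜} {U V Ω : Set (EuclideanSpace ℝ (Fin n))} {C ρ A δ : ℝ}
  {D : ℕ}

theorem dcEstimates_iff_derivNorm_le :
    DCEstimates p M S Ω f C ρ ↔
      ∀ l ∈ S, derivNorm f p Ω l ≤ ENNReal.ofReal (C * (ρ * rootSeq M l) ^ l) := by
  refine ⟨fun h l hl => derivNorm_le_iff.2 ?_, fun h α hα => derivNorm_le_iff.1 (h _ hα) α rfl⟩
  rintro α rfl
  exact h α hl

theorem DCEstimates.mono_set {S' : Set ℕ} (h : DCEstimates p M S' Ω f C ρ) (hS : S ⊆ S') :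
    DCEstimates p M S Ω f C ρ :=
  fun α hα => h α (hS hα)

theorem DCEstimates.mono_right (hM : ∀ j, 0 < M j) (hC : 0 < C) (hρ : 0 < ρ) {ρ' : ℝ}
    (hρ' : ρ ≤ ρ') (h : DCEstimates p M S Ω f C ρ) : DCEstimates p M S Ω f C ρ' := by
  intro α hα
  refine (h α hα).trans (ENNReal.ofReal_le_ofReal ?_)
  have := rootSeq_pos hM (multiOrder α)
  gcongr

theorem DCEstimates.derivNorm_le_of_le (hM : ∀ j, 0 < M j) (hC : 0 < C) (hρ : 0 < ρ)
    (h : DCEstimates p M S Ω f C ρ) {l : ℕ} (hl : l ∈ S) {T : ℝ} (hT : ρ * rootSeq M l ≤ T) :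
    derivNorm f p Ω l ≤ ENNReal.ofReal (C * T ^ l) := by
  refine (dcEstimates_iff_derivNorm_le.1 h l hl).trans (ENNReal.ofReal_le_ofReal ?_)
  have := rootSeq_pos hM l
  gcongr

theorem DCEstimates.derivNorm_left_le (hM : ∀ j, 0 < M j) (hA : 1 ≤ A) (hC : 0 < C) (hρ : 0 < ρ)
    (h : DCEstimates p M (range k) Ω f C ρ) (j : ℕ) :
    derivNorm f p Ω (k j) ≤ ENNReal.ofReal (C * (A * ρ * rootSeq M (k j)) ^ k j) := by
  refine h.derivNorm_le_of_le hM hC hρ (mem_range_self j) ?_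
  have := rootSeq_pos hM (k j)
  rw [mul_assoc]
  exact le_mul_of_one_le_left (by positivity) hA

theorem DCEstimates.derivNorm_right_le (hM : ∀ j, 0 < M j) (hC : 0 < C) (hρ : 0 < ρ)
    (hA : 0 < A) (hkA : ∀ j, rootSeq M (k (j + 1)) ≤ A * rootSeq M (k j)) (hk : StrictMono k)
    (h : DCEstimates p M (range k) Ω f C ρ) (j : ℕ) :
    derivNorm f p Ω (k j + (k (j + 1) - k j)) ≤
      ENNReal.ofReal ((A * ρ * rootSeq M (k j)) ^ (k (j + 1) - k j)) *
        ENNReal.ofReal (C * (A * ρ * rootSeq M (k j)) ^ k j) := by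
  have hle : k j ≤ k (j + 1) := hk.monotone j.le_succ
  have := rootSeq_pos hM (k j)
  rw [← ENNReal.ofReal_mul (by positivity), mul_left_comm, pow_sub_mul_pow _ hle,
    Nat.add_sub_of_le hle]
  refine h.derivNorm_le_of_le hM hC hρ (mem_range_self (j + 1)) ?_
  calc ρ * rootSeq M (k (j + 1)) ≤ ρ * (A * rootSeq M (k j)) := by gcongr; exact hkA j
    _ = A * ρ * rootSeq M (k j) := by ring

theorem DCEstimates.univ_of_range (hp : 1 ≤ p) (hk : IsBaseSeq k) (hM : ∀ j, 0 < M j)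
    (hmono : Monotone (rootSeq M)) (hA : 1 ≤ A)
    (hkA : ∀ j, rootSeq M (k (j + 1)) ≤ A * rootSeq M (k j)) (hf : ContDiff ℝ ∞ f)
    (hC : 0 < C) (hρ : 0 < ρ) (h : DCEstimates p M (range k) univ f C ρ) :
    DCEstimates p M univ univ f C (168 * A * ρ) := by
  refine dcEstimates_iff_derivNorm_le.2 fun l _ => ?_
  obtain ⟨j, hjl, hlj⟩ := hk.exists_le_lt l
  have hpos := rootSeq_pos hM (k j)
  have hA0 : 0 < A := one_pos.trans_le hA
  have hl := derivNorm_add_le hf hp (by positivity) (i := l - k j) (by omega)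
    (h.derivNorm_left_le hM hA hC hρ j) (h.derivNorm_right_le hM hC hρ hA0 hkA hk.strictMono j)
  rw [Nat.add_sub_of_le hjl, ← ENNReal.ofReal_mul (by positivity)] at hl
  refine hl.trans (ENNReal.ofReal_le_ofReal ?_)
  have hT : 0 < A * ρ * rootSeq M (k j) := by positivity
  set T := A * ρ * rootSeq M (k j)
  calc (168 * T) ^ (l - k j) * (C * T ^ k j)
      ≤ (168 * T) ^ (l - k j) * (C * (168 * T) ^ k j) := by gcongr; linarith
    _ = C * (168 * A * ρ * rootSeq M (k j)) ^ l := by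
        rw [mul_left_comm, pow_sub_mul_pow _ hjl, ← mul_assoc 168, ← mul_assoc 168]
    _ ≤ C * (168 * A * ρ * rootSeq M l) ^ l := by gcongr; exact hmono hjl

theorem DCEstimates.derivNorm_le_of_thickening (hp : 1 ≤ p) (hk : StrictMono k)
    (hM : ∀ j, 0 < M j) (hmono : Monotone (rootSeq M)) (hA : 1 ≤ A)
    (hkA : ∀ j, rootSeq M (k (j + 1)) ≤ A * rootSeq M (k j)) (hU : IsOpen U)
    (hf : ContDiffOn ℝ ∞ f U) (hVU : V ⊆ U) (hΩ : IsOpen Ω)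
    (hΩV : Metric.thickening ((n + 1) * δ) Ω ⊆ V) (hC : 0 < C) (hρ : 0 < ρ)
    (h : DCEstimates p M (range k) V f C ρ) {j : ℕ} (hD : k (j + 1) ≤ D * k j)
    (hδ : D * k j < δ * (A * ρ * rootSeq M (k j))) {l : ℕ} (hjl : k j ≤ l)
    (hlj : l < k (j + 1)) :
    derivNorm f p Ω l ≤ ENNReal.ofReal (C * (72 ^ (D * n) * A * ρ * rootSeq M l) ^ l) := by
  have hpos := rootSeq_pos hM (k j)
  have hA0 : 0 < A := one_pos.trans_le hA
  have hT : 0 < A * ρ * rootSeq M (k j) := by positivity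
  have hgap : ((k (j + 1) - k j : ℕ) : ℝ) / (A * ρ * rootSeq M (k j)) < δ :=
    (div_lt_iff₀ hT).2 (lt_of_le_of_lt (by exact_mod_cast (Nat.sub_le _ _).trans hD) hδ)
  have hl := derivNorm_add_le_of_thickening hU hf hVU hp hT hgap (i := l - k j) (by omega) hΩ hΩV
    (h.derivNorm_left_le hM hA hC hρ j) (h.derivNorm_right_le hM hC hρ hA0 hkA hk j)
  rw [Nat.add_sub_of_le hjl, ← ENNReal.ofReal_mul (by positivity)] at hl
  refine hl.trans (ENNReal.ofReal_le_ofReal ?_)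
  have hexp : (k (j + 1) - k j) * n ≤ D * n * l := by
    rw [mul_right_comm]
    exact Nat.mul_le_mul_right n ((Nat.sub_le _ _).trans (hD.trans (Nat.mul_le_mul_left D hjl)))
  set T := A * ρ * rootSeq M (k j) with hTdef
  calc 72 ^ ((k (j + 1) - k j) * n) * T ^ (l - k j) * (C * T ^ k j)
      ≤ 72 ^ (D * n * l) * T ^ (l - k j) * (C * T ^ k j) := by gcongr; norm_num
    _ = C * (72 ^ (D * n * l) * (T ^ (l - k j) * T ^ k j)) := by ring
    _ = C * (72 ^ (D * n) * A * ρ * rootSeq M (k j)) ^ l := by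
        rw [pow_sub_mul_pow _ hjl, pow_mul, ← mul_pow, hTdef]
        ring
    _ ≤ C * (72 ^ (D * n) * A * ρ * rootSeq M l) ^ l := by gcongr; exact hmono hjl

theorem DCEstimates.exists_univ_of_Ici (hM : ∀ j, 0 < M j) (hC : 0 < C) (hρ : 0 < ρ) {L : ℕ}
    (hfin : ∀ l, derivNorm f p Ω l < ⊤) (h : DCEstimates p M (Ici L) Ω f C ρ) :
    ∃ C' : ℝ, 0 < C' ∧ DCEstimates p M univ Ω f C' ρ := by
  have hpos (l : ℕ) : 0 < (ρ * rootSeq M l) ^ l := pow_pos (mul_pos hρ (rootSeq_pos hM l)) l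
  set c : ℕ → ℝ := fun l => (derivNorm f p Ω l).toReal / (ρ * rootSeq M l) ^ l
  have hc (l : ℕ) : 0 ≤ c l := div_nonneg ENNReal.toReal_nonneg (hpos l).le
  have hsum : 0 ≤ ∑ l ∈ Finset.range L, c l := Finset.sum_nonneg fun l _ => hc l
  refine ⟨C + ∑ l ∈ Finset.range L, c l, by positivity,
    dcEstimates_iff_derivNorm_le.2 fun l _ => ?_⟩
  rcases lt_or_ge l L with hl | hl
  · rw [← ENNReal.ofReal_toReal (hfin l).ne]
    refine ENNReal.ofReal_le_ofReal ((div_le_iff₀ (hpos l)).1 ?_)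
    exact (Finset.single_le_sum (fun l _ => hc l) (Finset.mem_range.2 hl)).trans
      (le_add_of_nonneg_left hC.le)
  · refine (dcEstimates_iff_derivNorm_le.1 h l hl).trans (ENNReal.ofReal_le_ofReal ?_)
    exact mul_le_mul_of_nonneg_right (le_add_of_nonneg_right hsum) (hpos l).le

theorem DCEstimates.exists_univ_of_range (hp : 1 ≤ p) (hk : IsBaseSeq k) (hM : ∀ j, 0 < M j)
    (hmono : Monotone (rootSeq M)) (hA : 1 ≤ A)
    (hkA : ∀ j, rootSeq M (k (j + 1)) ≤ A * rootSeq M (k j))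
    (hD : ∀ j, 1 ≤ j → k (j + 1) ≤ D * k j) (hU : IsOpen U) (hf : ContDiffOn ℝ ∞ f U)
    (hVU : V ⊆ U) (hΩ : IsOpen Ω) (hc : IsCompact (closure Ω)) (hΩU : closure Ω ⊆ U)
    (hΩV : Metric.thickening ((n + 1) * δ) Ω ⊆ V) (hC : 0 < C) (hρ : 0 < ρ)
    (h : DCEstimates p M (range k) V f C ρ)
    (hδ : ∀ᶠ l : ℕ in atTop, D * l < δ * (A * ρ * rootSeq M l)) :
    ∃ C' : ℝ, 0 < C' ∧ DCEstimates p M univ Ω f C' (72 ^ (D * n) * A * ρ) := by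
  have : 0 < A := one_pos.trans_le hA
  obtain ⟨J, hJ⟩ := eventually_atTop.1 (hk.strictMono.tendsto_atTop.eventually hδ)
  refine exists_univ_of_Ici hM hC (by positivity) (L := k (J + 1))
    (derivNorm_lt_top hU hf hc hΩU p) (dcEstimates_iff_derivNorm_le.2 fun l hl => ?_)
  obtain ⟨j, hjl, hlj⟩ := hk.exists_le_lt l
  have hJj : J < j := Nat.succ_lt_succ_iff.1 (hk.strictMono.lt_iff_lt.1 (hl.trans_lt hlj))
  exact h.derivNorm_le_of_thickening hp hk.strictMono hM hmono hA hkA hU hf hVU hΩ hΩV hC hρ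
    (hD j (by omega)) (hJ j hJj.le) hjl hlj

end Estimates

section Classes

variable {𝕜 : Type*} [RCLike 𝕜] {n : ℕ} {p : ℝ≥0∞} {M : ℕ → ℝ} {k : ℕ → ℕ}
  {U : Set (EuclideanSpace ℝ (Fin n))}

theorem DCType.Constants.mono {t : DCType} {P Q : ℝ → ℝ → Prop} (h : t.Constants P)
    (hPQ : ∀ C ρ, P C ρ → Q C ρ) : t.Constants Q := by
  cases t with
  | roumieu =>
    obtain ⟨C, hC, ρ, hρ, hP⟩ := h
    exact ⟨C, hC, ρ, hρ, hPQ _ _ hP⟩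
  | beurling =>
    intro ρ hρ
    obtain ⟨C, hC, hP⟩ := h ρ hρ
    exact ⟨C, hC, hPQ _ _ hP⟩

theorem DCType.Constants.of_scaling {t : DCType} {P Q : ℝ → ℝ → Prop} (h : t.Constants P)
    {B : ℝ} (hB : 0 < B)
    (hPQ : ∀ C ρ, 0 < C → 0 < ρ → P C ρ → ∃ C', 0 < C' ∧ Q C' (B * ρ)) : t.Constants Q := by
  cases t with
  | roumieu =>
    obtain ⟨C, hC, ρ, hρ, hP⟩ := h
    obtain ⟨C', hC', hQ⟩ := hPQ C ρ hC hρ hP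
    exact ⟨C', hC', B * ρ, by positivity, hQ⟩
  | beurling =>
    intro ρ hρ
    obtain ⟨C, hC, hP⟩ := h (ρ / B) (by positivity)
    simpa only [mul_div_cancel₀ _ hB.ne'] using hPQ C (ρ / B) hC (by positivity) hP

theorem lacunaryB_eq_classB (hp : 1 ≤ p) (hk : IsBaseSeq k) (hM : ∀ j, 0 < M j)
    (hmono : Monotone (rootSeq M))
    (hkM : BddAbove (range fun j : ℕ => rootSeq M (k (j + 1)) / rootSeq M (k j))) (t : DCType) :
    lacunaryB 𝕜 n t p M k = classB 𝕜 n t p M := by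
  obtain ⟨A, hA, hkA⟩ := exists_rootSeq_succ_le hM hkM
  refine Subset.antisymm (fun f hf => ⟨hf.1, ?_⟩) fun f hf =>
    ⟨hf.1, hf.2.mono fun C ρ h => h.mono_set (subset_univ _)⟩
  exact hf.2.of_scaling (B := 168 * A) (by positivity) fun C ρ hC hρ h =>
    ⟨C, hC, h.univ_of_range hp hk hM hmono hA hkA hf.1 hC hρ⟩

theorem lacunaryD_eq_classD (hk : IsBaseSeq k) (hM : ∀ j, 0 < M j)
    (hmono : Monotone (rootSeq M))
    (hkM : BddAbove (range fun j : ℕ => rootSeq M (k (j + 1)) / rootSeq M (k j))) (t : DCType) :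
    lacunaryD 𝕜 n t M k = classD 𝕜 n t M := by
  rw [lacunaryD, classD, lacunaryB_eq_classB le_top hk hM hmono hkM]

theorem classE_subset_lacunaryE (t : DCType) (p : ℝ≥0∞) (M : ℕ → ℝ) (k : ℕ → ℕ)
    (U : Set (EuclideanSpace ℝ (Fin n))) : classE 𝕜 t p M U ⊆ lacunaryE 𝕜 t p M k U :=
  fun _ hf =>
    ⟨hf.1, fun Ω hΩ hc hs => (hf.2 Ω hΩ hc hs).mono fun _ _ h => h.mono_set (subset_univ _)⟩

theorem exists_isCompact_closure_thickening {X : Type*} [PseudoMetricSpace X] [ProperSpace X]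
    {K W : Set X} (hW : IsOpen W) (hK : IsCompact (closure K)) (hKW : closure K ⊆ W) :
    ∃ ε : ℝ, 0 < ε ∧ IsCompact (closure (Metric.thickening ε K)) ∧
      closure (Metric.thickening ε K) ⊆ W := by
  obtain ⟨ε, hε, hεW⟩ := hK.exists_cthickening_subset_open hW hKW
  have hsub : closure (Metric.thickening ε K) ⊆ Metric.cthickening ε (closure K) :=
    (Metric.closure_thickening_subset_cthickening _ _).trans
      (Metric.cthickening_subset_of_subset _ subset_closure)
  exact ⟨ε, hε, hK.cthickening.of_isClosed_subset isClosed_closure hsub, hsub.trans hεW⟩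

theorem lacunaryE_roumieu_eq_classE (hp : 1 ≤ p) (hk : IsSpecialBaseSeq k) (hM : ∀ j, 0 < M j)
    (hmono : Monotone (rootSeq M))
    (hkM : BddAbove (range fun j : ℕ => rootSeq M (k (j + 1)) / rootSeq M (k j)))
    (hU : IsOpen U) (hbdd : BddAbove (range fun j : ℕ => (j : ℝ) / rootSeq M j)) :
    lacunaryE 𝕜 DCType.roumieu p M k U = classE 𝕜 DCType.roumieu p M U := by
  obtain ⟨A, hA, hkA⟩ := exists_rootSeq_succ_le hM hkM
  obtain ⟨D, hD⟩ := hk.exists_succ_le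
  obtain ⟨H, hH⟩ := hbdd
  have hH0 : 0 ≤ H := by simpa using hH (mem_range_self 0)
  refine Subset.antisymm (fun f hf => ⟨hf.1, fun Ω hΩ hc hs => ?_⟩) (classE_subset_lacunaryE ..)
  obtain ⟨ε, hε, hεc, hεU⟩ := exists_isCompact_closure_thickening hU hc hs
  obtain ⟨C, hC, ρ, hρ, h⟩ := hf.2 _ Metric.isOpen_thickening hεc hεU
  set δ := ε / (n + 1)
  have hδ : 0 < δ := by positivity
  have hεδ : (n + 1) * δ = ε := mul_div_cancel₀ _ (by positivity)
  set ρ' := ρ + D * H / δ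
  have hρρ' : ρ ≤ ρ' := le_add_of_nonneg_right (by positivity)
  have hρ' : 0 < ρ' := hρ.trans_le hρρ'
  have hlarge (l : ℕ) : D * l < δ * (A * ρ' * rootSeq M l) := by
    have hl := rootSeq_pos hM l
    calc (D * l : ℝ) ≤ D * (H * rootSeq M l) := by
          gcongr
          exact (div_le_iff₀ hl).1 (hH (mem_range_self l))
      _ < δ * ρ * rootSeq M l + D * (H * rootSeq M l) := lt_add_of_pos_left _ (by positivity)
      _ = δ * (1 * ρ' * rootSeq M l) := by
          simp only [ρ']
          field_simp
      _ ≤ δ * (A * ρ' * rootSeq M l) := by gcongr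
  obtain ⟨C', hC', h'⟩ := (h.mono_right hM hC hρ hρρ').exists_univ_of_range hp hk.toIsBaseSeq hM
    hmono hA hkA hD hU hf.1 (subset_closure.trans hεU) hΩ hc hs (by rw [hεδ]) hC hρ'
    (Eventually.of_forall hlarge)
  exact ⟨C', hC', _, by positivity, h'⟩

theorem lacunaryE_beurling_eq_classE (hp : 1 ≤ p) (hk : IsSpecialBaseSeq k) (hM : ∀ j, 0 < M j)
    (hmono : Monotone (rootSeq M))
    (hkM : BddAbove (range fun j : ℕ => rootSeq M (k (j + 1)) / rootSeq M (k j)))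
    (hU : IsOpen U) (hlim : Tendsto (fun j : ℕ => (j : ℝ) / rootSeq M j) atTop (𝓝 0)) :
    lacunaryE 𝕜 DCType.beurling p M k U = classE 𝕜 DCType.beurling p M U := by
  obtain ⟨A, hA, hkA⟩ := exists_rootSeq_succ_le hM hkM
  obtain ⟨D, hD⟩ := hk.exists_succ_le
  refine Subset.antisymm (fun f hf => ⟨hf.1, fun Ω hΩ hc hs => ?_⟩) (classE_subset_lacunaryE ..)
  obtain ⟨ε, hε, hεc, hεU⟩ := exists_isCompact_closure_thickening hU hc hs
  set δ := ε / (n + 1)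
  have : 0 < δ := by positivity
  have hεδ : (n + 1) * δ = ε := mul_div_cancel₀ _ (by positivity)
  refine (hf.2 _ Metric.isOpen_thickening hεc hεU).of_scaling (B := 72 ^ (D * n) * A)
    (by positivity) fun C ρ hC hρ h => ?_
  have hsmall : ∀ᶠ l : ℕ in atTop, D * l < δ * (A * ρ * rootSeq M l) := by
    have hDlim : Tendsto (fun l : ℕ => D * (l / rootSeq M l)) atTop (𝓝 0) := by
      simpa using hlim.const_mul (D : ℝ)
    filter_upwards [hDlim.eventually_lt_const (show 0 < δ * (A * ρ) by positivity)] with l hl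
    rwa [← mul_div_assoc, div_lt_iff₀ (rootSeq_pos hM l), mul_assoc] at hl
  exact h.exists_univ_of_range hp hk.toIsBaseSeq hM hmono hA hkA hD hU hf.1
    (subset_closure.trans hεU) hΩ hc hs (by rw [hεδ]) hC hρ hsmall

end Classes

end

theorem mainTheorem1_general {𝕜 : Type*} [RCLike 𝕜] (n : ℕ) (p : ℝ≥0∞) (hp : 1 ≤ p)
    (k : ℕ → ℕ) (hk : IsBaseSeq k) (M : ℕ → ℝ) (hM : ∀ j, 0 < M j)
    (hmono : Monotone (rootSeq M))
    (hkM : BddAbove (range fun j : ℕ => rootSeq M (k (j + 1)) / rootSeq M (k j))) :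
    (∀ t : DCType, lacunaryB 𝕜 n t p M k = classB 𝕜 n t p M) ∧
    (∀ t : DCType, lacunaryD 𝕜 n t M k = classD 𝕜 n t M) ∧
    (IsSpecialBaseSeq k → ∀ U : Set (EuclideanSpace ℝ (Fin n)), IsOpen U →
      (BddAbove (range fun j : ℕ => (j : ℝ) / rootSeq M j) →
        lacunaryE 𝕜 DCType.roumieu p M k U = classE 𝕜 DCType.roumieu p M U) ∧
      (Tendsto (fun j : ℕ => (j : ℝ) / rootSeq M j) atTop (𝓝 0) →
        lacunaryE 𝕜 DCType.beurling p M k U = classE 𝕜 DCType.beurling p M U)) :=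
  ⟨lacunaryB_eq_classB hp hk hM hmono hkM, lacunaryD_eq_classD hk hM hmono hkM, fun hks _ hU =>
    ⟨lacunaryE_roumieu_eq_classE hp hks hM hmono hkM hU,
      lacunaryE_beurling_eq_classE hp hks hM hmono hkM hU⟩⟩

theorem mainTheorem1 {𝕜 : Type*} [RCLike 𝕜] (n : ℕ) (p : ℝ≥0∞) (hp : 1 ≤ p)
    (k : ℕ → ℕ) (hk : IsBaseSeq k) (M : ℕ → ℝ) (hM : IsWeightSeq M)
    (hkM : BddAbove (range fun j : ℕ => rootSeq M (k (j + 1)) / rootSeq M (k j))) :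
    (∀ t : DCType, lacunaryB 𝕜 n t p M k = classB 𝕜 n t p M) ∧
    (∀ t : DCType, lacunaryD 𝕜 n t M k = classD 𝕜 n t M) ∧
    (IsSpecialBaseSeq k → ∀ U : Set (EuclideanSpace ℝ (Fin n)), IsOpen U →
      (BddAbove (range fun j : ℕ => (j : ℝ) / rootSeq M j) →
        lacunaryE 𝕜 DCType.roumieu p M k U = classE 𝕜 DCType.roumieu p M U) ∧
      (Tendsto (fun j : ℕ => (j : ℝ) / rootSeq M j) atTop (𝓝 0) →
        lacunaryE 𝕜 DCType.beurling p M k U = classE 𝕜 DCType.beurling p M U)) :=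
  mainTheorem1_general n p hp k hk M hM.pos hM.rootSeq_mono hkM
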